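/- All graphs are finite and simple; $G+H$ denotes disjoint union, $G\oplus H$ denotes join, and $nG$ is the disjoint union of $n$ copies of $G$. A cograph is a graph without an induced path on four vertices. A cluster is the complement of a complete multipartite graph (that is, a disjoint union of complete graphs). For $s,k\in\{0,1,2,\dots\}\cup\{\infty\}$, a graph is $(s,k)$-polar if its vertex set has a partition $(A,B)$, with empty sides allowed, such that $A$ induces a complete multipartite graph with at most $s$ parts and $B$ induces a cluster with at most $k$ components ($\infty$ means no bound). A cograph minimal $(s,k)$-polar obstruction is a cograph that is not $(s,k)$-polar but all of whose proper induced subgraphs are $(s,k)$-polar. Theorem. Let $k$ be a positive integer, and let $G$ be a graph without components isomorphic to $P_3$ (the path on three vertices). Then $G$ is a disconnected cograph minimal $(\infty,k)$-polar obstruction without isolated vertices if and only if there are positive integers $k_1,k_2$ and cographs $H_1,H_2$ such that 1. $G\cong H_1+H_2$; 2. $k=k_1+k_2-1$; 3. for each $i\in\{1,2\}$, either $H_i$ is a cograph minimal $(1,k_i-1)$-polar obstruction that is neither a cograph minimal $(1,\infty)$-polar obstruction nor isomorphic to $k_iK_2$, or $k_i\ge 2$ and $H_i\cong (k_i-2)K_2+(K_1\oplus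 2K_2)$; 4. for $\{i,j\}=\{1,2\}$, if $k_i\ge 2$, $H_i\cong (k_i-2)K_2+(K_1\oplus 2K_2)$ and $H_j$ is a cograph minimal $(1,k_j-1)$-polar obstruction, then exactly one component of $H_j$ is not isomorphic to $K_2$. -/

import Mathlib

universe u

namespace SimpleGraph

variable {V W : Type*}

/-- A cograph is a graph without an induced path on four vertices. -/
def IsCograph (G : SimpleGraph V) : Prop :=
  ¬ (pathGraph 4 ⊴ G)

/-- `G` is complete multipartite with at most `s` parts (`s = ⊤`: no bound). The parts are the
classes of the equivalence relation "equal or not adjacent". -/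
def IsCompleteMultipartiteAtMost (G : SimpleGraph V) (s : ℕ∞) : Prop :=
  ∃ h : G.IsCompleteMultipartite, ENat.card (Quotient h.setoid) ≤ s

/-- A cluster is the complement of a complete multipartite graph. -/
def IsCluster (G : SimpleGraph V) : Prop :=
  Gᶜ.IsCompleteMultipartite

/-- A `k`-cluster is a cluster with at most `k` components (`k = ⊤`: no bound). -/
def IsClusterAtMost (G : SimpleGraph V) (k : ℕ∞) : Prop :=
  G.IsCluster ∧ ENat.card G.ConnectedComponent ≤ k

/-- `G` is `(s, k)`-polar: its vertex set is partitioned into `A` (possibly empty), inducing a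
complete multipartite graph with at most `s` parts, and its complement (possibly empty), inducing
a `k`-cluster. -/
def IsPolar (G : SimpleGraph V) (s k : ℕ∞) : Prop :=
  ∃ A : Set V, (G.induce A).IsCompleteMultipartiteAtMost s ∧ (G.induce Aᶜ).IsClusterAtMost k

/-- `G` is a cograph minimal `(s, k)`-polar obstruction: a cograph which is not `(s, k)`-polar,
but all of whose proper induced subgraphs are. -/
def IsCographMinObstruction (G : SimpleGraph V) (s k : ℕ∞) : Prop :=
  G.IsCograph ∧ ¬ G.IsPolar s k ∧ ∀ S : Set V, S ≠ Set.univ → (G.induce S).IsPolar s k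

/-- The join of two graphs: their disjoint union with all edges between them added. -/
def join (G : SimpleGraph V) (H : SimpleGraph W) : SimpleGraph (V ⊕ W) :=
  (G ⊕g H) ⊔ completeBipartiteGraph V W

/-- The disjoint union `nG` of `n` copies of `G`. -/
def copies (n : ℕ) (G : SimpleGraph V) : SimpleGraph (Fin n × V) where
  Adj x y := x.1 = y.1 ∧ G.Adj x.2 y.2
  symm := ⟨fun _ _ h => ⟨h.1.symm, h.2.symm⟩⟩
  loopless := ⟨fun x h => G.loopless.irrefl x.2 h.2⟩

/-- `G` and `H` are isomorphic. -/
def IsIsomorphic (G : SimpleGraph V) (H : SimpleGraph W) : Prop :=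
  Nonempty (G ≃g H)

/-- `G ≅ nK₂`. -/
def IsCopiesK2 (G : SimpleGraph V) (n : ℕ) : Prop :=
  G.IsIsomorphic (copies n (completeGraph (Fin 2)))

/-- `k ≥ 2` and `G ≅ (k - 2)K₂ + (K₁ ⊕ 2K₂)`, where `+` is disjoint union and `⊕` is join. -/
def IsExceptional (G : SimpleGraph V) (k : ℕ) : Prop :=
  2 ≤ k ∧ G.IsIsomorphic
    (copies (k - 2) (completeGraph (Fin 2)) ⊕g
      join (completeGraph (Fin 1)) (copies 2 (completeGraph (Fin 2))))

/-- `G` is a cograph minimal `(1, k - 1)`-polar obstruction that is neither a cograph minimal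
`(1, ∞)`-polar obstruction nor isomorphic to `kK₂` (used for `k ≥ 1`). -/
def IsOrdinary (G : SimpleGraph V) (k : ℕ) : Prop :=
  G.IsCographMinObstruction 1 ((k - 1 : ℕ) : ℕ∞) ∧
    ¬ G.IsCographMinObstruction 1 ⊤ ∧ ¬ G.IsCopiesK2 k

end SimpleGraph

/-! Write m(S), in Lean `monoNumber`, for the least k such that S is (1,k)-polar. It is additive
over disjoint unions (`Monopolar.monoNumber_union`). A complete multipartite graph with an edge is
connected, so a disjoint union S + T is (∞,k)-polar only if it is (1,k)-polar, or one side is a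
cluster with j components and the other is (∞,i)-polar with i + j ≤ k (`PolarOn.dichotomy`).

A connected cograph with 2 ≤ m(S) < ∞ is the join of an edgeless set and a cluster with m(S)
components (`P4Free.exists_join`). Moving one clique to the edgeless side makes it (∞,m(S)-1)-polar
(`P4Free.polarOn_pred`). If moreover each vertex deletion lowers m or leaves a cluster, then every
deletion lowers m, or the graph is the butterfly K₁ ⊕ 2K₂ (`P4Free.butterflyOn`).

Sufficiency: the ordinary graphs are the monopolar non-clusters with m = k in which every vertex is
critical (`isOrdinary_iff`); in an exceptional graph only the centre of the butterfly is not
critical, and its deletion leaves a cluster with k components. Take two such summands with m(S) +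
m(T) = k + 1. Neither is a cluster, so the dichotomy and additivity exclude (∞,k)-polarity. Deleting
a critical vertex makes the union (1,k)-polar; deleting a butterfly centre requires the other side
to be (∞,m-1)-polar. For a critical graph that is not a cluster this means having exactly one
component other than K₂, which is condition 4.

Necessity: a minimal obstruction is monopolar (`MinimalNotPolar.monopolar`) and has a component c
such that neither c nor the rest is a cluster (`MinimalNotPolar.exists_component`). Then m(G) = k +
1, and c and the rest are the two summands. The absence of P₃ components enters through
`exists_mem_supp_ne`. -/

namespace SimpleGraph

/-! ### Polarity of vertex subsets, and the monopolar number. -/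

section SetLevel

variable {V : Type*} (G : SimpleGraph V)

/-- No edge of `G` joins two vertices of `A`. -/
def Edgeless (A : Set V) : Prop := ∀ x ∈ A, ∀ y ∈ A, ¬ G.Adj x y

/-- `B` induces a disjoint union of complete graphs. -/
def ClusterOn (B : Set V) : Prop :=
  ∀ x ∈ B, ∀ y ∈ B, ∀ z ∈ B, G.Adj x y → G.Adj y z → x ≠ z → G.Adj x z

/-- `A` induces a complete multipartite graph. -/
def MultipartiteOn (A : Set V) : Prop :=
  ∀ x ∈ A, ∀ y ∈ A, ∀ z ∈ A, ¬ G.Adj x y → ¬ G.Adj y z → ¬ G.Adj x z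

/-- `B` induces a cluster with at most `k` components, the components being colour classes. -/
def ClusterColorable (B : Set V) (k : ℕ) : Prop :=
  ∃ c : V → ℕ, (∀ x ∈ B, c x < k) ∧ ∀ x ∈ B, ∀ y ∈ B, x ≠ y → (G.Adj x y ↔ c x = c y)

/-- `S` induces a `(1, k)`-polar graph. -/
def MonopolarOn (S : Set V) (k : ℕ) : Prop :=
  ∃ A : Set V, G.Edgeless (S ∩ A) ∧ G.ClusterColorable (S \ A) k

/-- `S` induces an `(∞, k)`-polar graph. -/
def PolarOn (S : Set V) (k : ℕ) : Prop :=
  ∃ A : Set V, G.MultipartiteOn (S ∩ A) ∧ G.ClusterColorable (S \ A) k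

/-- `S` induces a `(1, ∞)`-polar graph. -/
def Monopolar (S : Set V) : Prop := ∃ k, G.MonopolarOn S k

/-- The least `k` for which `S` induces a `(1, k)`-polar graph. -/
noncomputable def monoNumber (S : Set V) : ℕ := sInf {k | G.MonopolarOn S k}

/-- No edge of `G` joins `S` and `T`. -/
def Anticomplete (S T : Set V) : Prop := ∀ x ∈ S, ∀ y ∈ T, ¬ G.Adj x y

/-- `G` has no induced path on four vertices. -/
def P4Free : Prop :=
  ∀ a b c d, G.Adj a b → G.Adj b c → G.Adj c d → G.Adj a c ∨ G.Adj b d ∨ G.Adj a d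

/-- Any two nonadjacent vertices of `S` have a common neighbour in `S`. -/
def DiamTwo (S : Set V) : Prop :=
  ∀ x ∈ S, ∀ y ∈ S, x ≠ y → ¬ G.Adj x y → ∃ w ∈ S, G.Adj x w ∧ G.Adj w y

/-- No vertex of `S` is isolated in `S`. -/
def NoIsolatedOn (S : Set V) : Prop := ∀ x ∈ S, ∃ y ∈ S, G.Adj x y

variable {G} {A B C R S T : Set V} {u v w : V} {i j k l : ℕ}

theorem Anticomplete.symm (h : G.Anticomplete S T) : G.Anticomplete T S :=
  fun x hx y hy hxy => h y hy x hx hxy.symm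

theorem Anticomplete.mono (h : G.Anticomplete S T) (hA : A ⊆ S) (hB : B ⊆ T) :
    G.Anticomplete A B := fun x hx y hy => h x (hA hx) y (hB hy)

theorem Edgeless.mono (h : G.Edgeless B) (hAB : A ⊆ B) : G.Edgeless A :=
  fun x hx y hy => h x (hAB hx) y (hAB hy)

theorem ClusterOn.mono (h : G.ClusterOn B) (hAB : A ⊆ B) : G.ClusterOn A :=
  fun x hx y hy z hz => h x (hAB hx) y (hAB hy) z (hAB hz)

theorem MultipartiteOn.mono (h : G.MultipartiteOn B) (hAB : A ⊆ B) : G.MultipartiteOn A :=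
  fun x hx y hy z hz => h x (hAB hx) y (hAB hy) z (hAB hz)

theorem Edgeless.multipartiteOn (h : G.Edgeless A) : G.MultipartiteOn A :=
  fun x hx _ _ z hz _ _ => h x hx z hz

theorem ClusterOn.union (hS : G.ClusterOn S) (hT : G.ClusterOn T) (h : G.Anticomplete S T) :
    G.ClusterOn (S ∪ T) := by
  rintro x (hx | hx) y (hy | hy) z (hz | hz) hxy hyz hxz
  · exact hS x hx y hy z hz hxy hyz hxz
  · exact absurd hyz (h y hy z hz)
  · exact absurd hxy (h x hx y hy)
  · exact absurd hxy (h x hx y hy)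
  · exact absurd hxy.symm (h y hy x hx)
  · exact absurd hxy.symm (h y hy x hx)
  · exact absurd hyz.symm (h z hz y hy)
  · exact hT x hx y hy z hz hxy hyz hxz

theorem ClusterColorable.mono (h : G.ClusterColorable B k) (hAB : A ⊆ B) (hkl : k ≤ l) :
    G.ClusterColorable A l := by
  obtain ⟨c, hc, h⟩ := h
  exact ⟨c, fun x hx => (hc x (hAB hx)).trans_le hkl,
    fun x hx y hy => h x (hAB hx) y (hAB hy)⟩

theorem ClusterColorable.clusterOn (h : G.ClusterColorable B k) : G.ClusterOn B := by
  obtain ⟨c, -, h⟩ := h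
  intro x hx y hy z hz hxy hyz hxz
  rw [h x hx z hz hxz, (h x hx y hy hxy.ne).1 hxy, (h y hy z hz hyz.ne).1 hyz]

theorem clusterColorable_empty : G.ClusterColorable ∅ k :=
  ⟨fun _ => 0, by simp, by simp⟩

theorem clusterColorable_of_clique (h : ∀ x ∈ B, ∀ y ∈ B, x ≠ y → G.Adj x y) :
    G.ClusterColorable B 1 :=
  ⟨fun _ => 0, by simp, fun x hx y hy hxy => by simp [h x hx y hy hxy]⟩

/-- Allows components to be labelled by elements of any type; only the number of labels used on B
matters. -/
theorem clusterColorable_of_map [Finite V] {α : Type*} (c : V → α)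
    (h : ∀ x ∈ B, ∀ y ∈ B, x ≠ y → (G.Adj x y ↔ c x = c y)) :
    G.ClusterColorable B (c '' B).ncard := by
  classical
  have hfin : (c '' B).Finite := B.toFinite.image c
  have : Finite (c '' B) := hfin
  let e : (c '' B) ≃ Fin (c '' B).ncard := Finite.equivFinOfCardEq (Nat.card_coe_set_eq _)
  refine ⟨fun x => if hx : x ∈ B then e ⟨c x, x, hx, rfl⟩ else 0, fun x hx => ?_,
    fun x hx y hy hxy => ?_⟩
  · simp [hx]
  · simp only [hx, hy, dite_true, Fin.val_inj, e.injective.eq_iff]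
    exact (h x hx y hy hxy).trans ⟨fun e => Subtype.ext e, fun e => congrArg Subtype.val e⟩

theorem ClusterOn.exists_colorable [Finite V] (h : G.ClusterOn B) :
    ∃ k, G.ClusterColorable B k := by
  -- In a cluster the closed neighbourhoods are the components, so they serve as labels.
  refine ⟨_, clusterColorable_of_map (fun x => {y | y ∈ B ∧ (y = x ∨ G.Adj x y)}) ?_⟩
  intro x hx y hy hxy
  constructor
  · intro hadj
    ext z
    simp only [Set.mem_ofPred_eq]
    refine and_congr_right fun hz => ⟨?_, ?_⟩
    · rintro (rfl | hz')
      · exact Or.inr hadj.symm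
      · by_cases hzy : z = y
        · exact Or.inl hzy
        · exact Or.inr (h y hy x hx z hz hadj.symm hz' (Ne.symm hzy))
    · rintro (rfl | hz')
      · exact Or.inr hadj
      · by_cases hzx : z = x
        · exact Or.inl hzx
        · exact Or.inr (h x hx y hy z hz hadj hz' (Ne.symm hzx))
  · intro heq
    have : y ∈ {z | z ∈ B ∧ (z = x ∨ G.Adj x z)} := by
      rw [heq]; exact ⟨hy, Or.inl rfl⟩
    exact this.2.resolve_left (Ne.symm hxy)

theorem ClusterColorable.union (hS : G.ClusterColorable S i) (hT : G.ClusterColorable T j)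
    (hdis : Disjoint S T) (h : G.Anticomplete S T) : G.ClusterColorable (S ∪ T) (i + j) := by
  classical
  obtain ⟨c, hc, hS⟩ := hS
  obtain ⟨d, hd, hT⟩ := hT
  have hn : ∀ x ∈ T, x ∉ S := fun x hx hx' => Set.disjoint_left.1 hdis hx' hx
  refine ⟨fun x => if x ∈ S then c x else i + d x, ?_, ?_⟩
  · rintro x (hx | hx)
    · have := hc x hx; simp only [hx, if_true]; omega
    · have := hd x hx; simp only [hn x hx, if_false]; omega
  · rintro x (hx | hx) y (hy | hy) hxy
    · simp only [hx, hy, if_true]; exact hS x hx y hy hxy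
    · simp only [hx, hn y hy, if_true, if_false, h x hx y hy, false_iff]
      have := hc x hx; omega
    · simp only [hy, hn x hx, if_true, if_false, h.symm x hx y hy, false_iff]
      have := hc y hy; omega
    · simp only [hn x hx, hn y hy, if_false, Nat.add_left_cancel_iff]
      exact hT x hx y hy hxy

/-- Equal colours force adjacency, so S and T use disjoint sets of colours. -/
theorem ClusterColorable.split [Finite V] (h : G.ClusterColorable (S ∪ T) k)
    (hdis : Disjoint S T) (hanti : G.Anticomplete S T) :
    ∃ i j, i + j ≤ k ∧ G.ClusterColorable S i ∧ G.ClusterColorable T j := by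
  obtain ⟨c, hc, h⟩ := h
  refine ⟨(c '' S).ncard, (c '' T).ncard, ?_,
    clusterColorable_of_map c fun x hx y hy => h x (Or.inl hx) y (Or.inl hy),
    clusterColorable_of_map c fun x hx y hy => h x (Or.inr hx) y (Or.inr hy)⟩
  rw [← Set.ncard_union_eq ?_ (S.toFinite.image c) (T.toFinite.image c), ← Set.image_union]
  · have hsub : c '' (S ∪ T) ⊆ Set.Iio k := by rintro _ ⟨x, hx, rfl⟩; exact hc x hx
    simpa [Set.ncard_eq_toFinset_card'] using Set.ncard_le_ncard hsub (Set.finite_Iio k)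
  · rw [Set.disjoint_left]
    rintro _ ⟨x, hx, rfl⟩ ⟨y, hy, hxy⟩
    have hne : x ≠ y := fun e => Set.disjoint_left.1 hdis hx (e ▸ hy)
    exact hanti x hx y hy ((h x (Or.inl hx) y (Or.inr hy) hne).2 hxy.symm)

/-- A vertex with a closed twin in a cluster can be added to it. -/
theorem ClusterColorable.insert_twin (h : G.ClusterColorable B k) (hw : w ∈ B)
    (hvw : G.Adj v w) (htwin : ∀ b ∈ B, b ≠ w → b ≠ v → (G.Adj v b ↔ G.Adj w b)) :
    G.ClusterColorable (insert v B) k := by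
  classical
  obtain ⟨c, hc, h⟩ := h
  by_cases hv : v ∈ B
  · rw [Set.insert_eq_of_mem hv]; exact ⟨c, hc, h⟩
  have hne : ∀ b ∈ B, b ≠ v := fun b hb e => hv (e ▸ hb)
  have key : ∀ b ∈ B, (G.Adj v b ↔ c w = c b) := by
    intro b hb
    by_cases hbw : b = w
    · subst hbw; simp [hvw]
    · rw [htwin b hb hbw (hne b hb), h w hw b hb (Ne.symm hbw)]
  refine ⟨Function.update c v (c w), ?_, ?_⟩
  · rintro x (rfl | hx)
    · simpa using hc w hw
    · simpa [hne x hx] using hc x hx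
  · rintro x (rfl | hx) y (rfl | hy) hxy
    · exact absurd rfl hxy
    · simpa [hne y hy] using key y hy
    · rw [G.adj_comm]
      simpa [hne x hx, eq_comm] using key x hx
    · simpa [hne x hx, hne y hy] using h x hx y hy hxy

theorem ClusterColorable.insert_new (h : G.ClusterColorable B k) (hv : ∀ b ∈ B, ¬ G.Adj v b) :
    G.ClusterColorable (insert v B) (k + 1) := by
  by_cases hvB : v ∈ B
  · rw [Set.insert_eq_of_mem hvB]; exact h.mono subset_rfl (Nat.le_succ k)
  · rw [← Set.union_singleton]
    refine h.union (clusterColorable_of_clique ?_) (by simpa) ?_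
    · rintro x rfl y rfl hxy; exact absurd rfl hxy
    · rintro x hx y rfl hxy; exact hv x hx hxy.symm

theorem MonopolarOn.mono (h : G.MonopolarOn T k) (hST : S ⊆ T) (hkl : k ≤ l) :
    G.MonopolarOn S l := by
  obtain ⟨A, hA, hB⟩ := h
  exact ⟨A, hA.mono (Set.inter_subset_inter_left A hST),
    hB.mono (Set.sdiff_subset_sdiff_left hST) hkl⟩

theorem PolarOn.mono (h : G.PolarOn T k) (hST : S ⊆ T) (hkl : k ≤ l) : G.PolarOn S l := by
  obtain ⟨A, hA, hB⟩ := h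
  exact ⟨A, hA.mono (Set.inter_subset_inter_left A hST),
    hB.mono (Set.sdiff_subset_sdiff_left hST) hkl⟩

theorem MonopolarOn.polarOn (h : G.MonopolarOn S k) : G.PolarOn S k := by
  obtain ⟨A, hA, hB⟩ := h
  exact ⟨A, hA.multipartiteOn, hB⟩

theorem MonopolarOn.monopolar (h : G.MonopolarOn S k) : G.Monopolar S := ⟨k, h⟩

theorem Monopolar.mono (h : G.Monopolar T) (hST : S ⊆ T) : G.Monopolar S :=
  h.imp fun _ h => h.mono hST le_rfl

/-- The infimum over an empty set is 0, so `monoNumber` is meaningful only under `Monopolar`. -/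
theorem Monopolar.monopolarOn (h : G.Monopolar S) : G.MonopolarOn S (G.monoNumber S) :=
  Nat.sInf_mem (s := {k | G.MonopolarOn S k}) h

theorem MonopolarOn.monoNumber_le (h : G.MonopolarOn S k) : G.monoNumber S ≤ k :=
  Nat.sInf_le (s := {k | G.MonopolarOn S k}) h

theorem Monopolar.monopolarOn_iff (h : G.Monopolar S) :
    G.MonopolarOn S k ↔ G.monoNumber S ≤ k :=
  ⟨fun h => h.monoNumber_le, fun hk => h.monopolarOn.mono subset_rfl hk⟩

theorem Monopolar.monoNumber_mono (h : G.Monopolar T) (hST : S ⊆ T) :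
    G.monoNumber S ≤ G.monoNumber T :=
  (h.monopolarOn.mono hST le_rfl).monoNumber_le

theorem ClusterColorable.monopolarOn (h : G.ClusterColorable S k) : G.MonopolarOn S k :=
  ⟨∅, by simp [Edgeless], by simpa using h⟩

theorem Monopolar.edgeless_of_monoNumber_eq_zero (h : G.Monopolar S)
    (h0 : G.monoNumber S = 0) : G.Edgeless S := by
  obtain ⟨A, hA, c, hc, -⟩ := h0 ▸ h.monopolarOn
  have hSA : S ⊆ S ∩ A := fun x hx => ⟨hx, by
    by_contra hxA; exact absurd (hc x ⟨hx, hxA⟩) (Nat.not_lt_zero _)⟩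
  exact hA.mono hSA

theorem Monopolar.monoNumber_pos (h : G.Monopolar S) (hu : u ∈ S) (hv : v ∈ S)
    (huv : G.Adj u v) : 0 < G.monoNumber S :=
  Nat.pos_of_ne_zero fun h0 => h.edgeless_of_monoNumber_eq_zero h0 u hu v hv huv

theorem Edgeless.union (hS : G.Edgeless S) (hT : G.Edgeless T) (h : G.Anticomplete S T) :
    G.Edgeless (S ∪ T) := by
  rintro x (hx | hx) y (hy | hy)
  · exact hS x hx y hy
  · exact h x hx y hy
  · exact h.symm x hx y hy
  · exact hT x hx y hy

theorem MonopolarOn.union (hS : G.MonopolarOn S i) (hT : G.MonopolarOn T j)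
    (hdis : Disjoint S T) (h : G.Anticomplete S T) : G.MonopolarOn (S ∪ T) (i + j) := by
  obtain ⟨A, hA, hA'⟩ := hS
  obtain ⟨B, hB, hB'⟩ := hT
  refine ⟨(S ∩ A) ∪ (T ∩ B), ?_, ?_⟩
  · refine (hA.union hB (h.mono Set.inter_subset_left Set.inter_subset_left)).mono
      Set.inter_subset_right
  · refine (hA'.union hB' (hdis.mono Set.sdiff_subset Set.sdiff_subset)
      (h.mono Set.sdiff_subset Set.sdiff_subset)).mono ?_ le_rfl
    rintro x ⟨hx | hx, hx'⟩
    · exact Or.inl ⟨hx, fun hxA => hx' (Or.inl ⟨hx, hxA⟩)⟩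
    · exact Or.inr ⟨hx, fun hxA => hx' (Or.inr ⟨hx, hxA⟩)⟩

theorem MonopolarOn.split [Finite V] (h : G.MonopolarOn (S ∪ T) k)
    (hdis : Disjoint S T) (hanti : G.Anticomplete S T) :
    ∃ i j, i + j ≤ k ∧ G.MonopolarOn S i ∧ G.MonopolarOn T j := by
  obtain ⟨A, hA, hB⟩ := h
  rw [Set.union_sdiff_distrib] at hB
  obtain ⟨i, j, hij, hi, hj⟩ := hB.split (hdis.mono Set.sdiff_subset Set.sdiff_subset)
    (hanti.mono Set.sdiff_subset Set.sdiff_subset)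
  exact ⟨i, j, hij, ⟨A, hA.mono (Set.inter_subset_inter_left A Set.subset_union_left), hi⟩,
    ⟨A, hA.mono (Set.inter_subset_inter_left A Set.subset_union_right), hj⟩⟩

theorem Monopolar.union (hS : G.Monopolar S) (hT : G.Monopolar T)
    (hdis : Disjoint S T) (h : G.Anticomplete S T) : G.Monopolar (S ∪ T) :=
  (hS.monopolarOn.union hT.monopolarOn hdis h).monopolar

theorem Monopolar.monoNumber_union [Finite V] (hS : G.Monopolar S) (hT : G.Monopolar T)
    (hdis : Disjoint S T) (h : G.Anticomplete S T) :
    G.monoNumber (S ∪ T) = G.monoNumber S + G.monoNumber T := by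
  refine le_antisymm (hS.monopolarOn.union hT.monopolarOn hdis h).monoNumber_le ?_
  obtain ⟨i, j, hij, hi, hj⟩ := (hS.union hT hdis h).monopolarOn.split hdis h
  have := hi.monoNumber_le
  have := hj.monoNumber_le
  omega

/-- The monopolar number is additive over a union of connected components. -/
theorem Monopolar.monoNumber_add_diff [Finite V] (hT : G.Monopolar T) (hST : S ⊆ T)
    (h : G.Anticomplete S (T \ S)) :
    G.monoNumber T = G.monoNumber S + G.monoNumber (T \ S) := by
  rw [← (hT.mono hST).monoNumber_union (hT.mono Set.sdiff_subset) Set.disjoint_sdiff_right h,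
    Set.union_sdiff_cancel hST]

/-- Converse of the cluster alternatives in `PolarOn.dichotomy`: all of T joins the cluster side. -/
theorem PolarOn.union_clusterColorable (hS : G.PolarOn S i) (hT : G.ClusterColorable T j)
    (hdis : Disjoint S T) (h : G.Anticomplete S T) : G.PolarOn (S ∪ T) (i + j) := by
  obtain ⟨A, hA, hB⟩ := hS
  refine ⟨S ∩ A, hA.mono Set.inter_subset_right, ?_⟩
  refine (hB.union hT (hdis.mono_left Set.sdiff_subset)
    (h.mono Set.sdiff_subset subset_rfl)).mono ?_ le_rfl
  rintro x ⟨hx | hx, hx'⟩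
  · exact Or.inl ⟨hx, fun hxA => hx' ⟨hx, hxA⟩⟩
  · exact Or.inr hx

/-- If the neighbours of `v` in `S` are closed twins of `v`, then deleting `v` lowers the
monopolar number by at most one. -/
theorem Monopolar.monoNumber_le_diff_singleton (h : G.Monopolar S)
    (htwin : ∀ w ∈ S, G.Adj v w → ∀ b ∈ S, b ≠ w → b ≠ v → (G.Adj v b ↔ G.Adj w b)) :
    G.monoNumber S ≤ G.monoNumber (S \ {v}) + 1 := by
  obtain ⟨A, hA, hB⟩ := (h.mono (Set.sdiff_subset (t := {v}))).monopolarOn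
  refine MonopolarOn.monoNumber_le ⟨A \ {v}, hA.mono ?_, ?_⟩
  · rintro x ⟨hx, hxA, hxv⟩; exact ⟨⟨hx, hxv⟩, hxA⟩
  have hsub : S \ (A \ {v}) ⊆ insert v ((S \ {v}) \ A) := by
    rintro x ⟨hx, hxA⟩
    by_cases hxv : x = v
    · exact Or.inl hxv
    · exact Or.inr ⟨⟨hx, hxv⟩, fun h => hxA ⟨h, hxv⟩⟩
  -- Put v on the cluster side: it joins the clique of a neighbour there at no cost, or forms a new
  -- component.
  by_cases hw : ∃ w ∈ (S \ {v}) \ A, G.Adj v w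
  · obtain ⟨w, hw, hvw⟩ := hw
    exact (hB.insert_twin hw hvw fun b hb => htwin w hw.1.1 hvw b hb.1.1).mono hsub
      (Nat.le_succ _)
  · push Not at hw
    exact (hB.insert_new hw).mono hsub le_rfl

theorem ClusterOn.closed_twin (h : G.ClusterOn B) (hv : v ∈ B) :
    ∀ w ∈ B, G.Adj v w → ∀ b ∈ B, b ≠ w → b ≠ v → (G.Adj v b ↔ G.Adj w b) := by
  intro w hw hvw b hb hbw hbv
  exact ⟨fun hvb => h w hw v hv b hb hvw.symm hvb (Ne.symm hbw),
    fun hwb => h v hv w hw b hb hvw hwb (Ne.symm hbv)⟩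

/-- In a cluster without isolated vertices, every component counts for the monopolar number. -/
theorem ClusterOn.clusterColorable_of_monopolarOn (h : G.ClusterOn B) (hB : G.NoIsolatedOn B)
    (hm : G.MonopolarOn B k) : G.ClusterColorable B k := by
  classical
  obtain ⟨A, hA, c, hc, hcol⟩ := hm
  -- The edgeless set A contains at most one end of an edge, so every component of B has a vertex
  -- outside A; each x takes the colour of such a representative.
  have hr : ∀ x, ∃ y, x ∈ B → y ∈ B \ A ∧ (x = y ∨ G.Adj x y) := by
    intro x
    by_cases hx : x ∈ B
    · by_cases hxA : x ∈ A
      · obtain ⟨y, hy, hxy⟩ := hB x hx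
        exact ⟨y, fun _ => ⟨⟨hy, fun hyA => hA x ⟨hx, hxA⟩ y ⟨hy, hyA⟩ hxy⟩, Or.inr hxy⟩⟩
      · exact ⟨x, fun _ => ⟨⟨hx, hxA⟩, Or.inl rfl⟩⟩
    · exact ⟨x, fun h => absurd h hx⟩
  choose r hr using hr
  have trans : ∀ x ∈ B, ∀ y ∈ B, ∀ z ∈ B, (x = y ∨ G.Adj x y) → (y = z ∨ G.Adj y z) →
      (x = z ∨ G.Adj x z) := by
    rintro x hx y hy z hz (rfl | hxy) (rfl | hyz)
    · exact Or.inl rfl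
    · exact Or.inr hyz
    · exact Or.inr hxy
    · by_cases hxz : x = z
      · exact Or.inl hxz
      · exact Or.inr (h x hx y hy z hz hxy hyz hxz)
  have symm : ∀ {x y}, (x = y ∨ G.Adj x y) → (y = x ∨ G.Adj y x) := fun h =>
    h.imp Eq.symm Adj.symm
  refine ⟨c ∘ r, fun x hx => hc _ (hr x hx).1, fun x hx y hy hxy => ?_⟩
  obtain ⟨hrx, hxr⟩ := hr x hx
  obtain ⟨hry, hyr⟩ := hr y hy
  have hrr : c (r x) = c (r y) ↔ (r x = r y ∨ G.Adj (r x) (r y)) := by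
    by_cases he : r x = r y
    · simp [he]
    · simp [he, hcol _ hrx _ hry he]
  simp only [Function.comp, hrr]
  constructor
  · intro hadj
    exact trans _ hrx.1 _ hx _ hry.1 (symm hxr) (trans _ hx _ hy _ hry.1 (Or.inr hadj) hyr)
  · intro hadj
    have := trans _ hx _ hrx.1 _ hy hxr (trans _ hrx.1 _ hry.1 _ hy hadj (symm hyr))
    exact this.resolve_left hxy

end SetLevel

/-! ### Connected cographs of finite monopolar number. -/

section Connected

variable {V : Type*} {G : SimpleGraph V} {A B C R S T : Set V} {u v w : V} {i j k l : ℕ}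

/-- Induction along a walk: a path with three edges has a chord, and any chord shortens it. -/
theorem P4Free.reachable (hG : G.P4Free) (h : G.Reachable u v) :
    u = v ∨ G.Adj u v ∨ ∃ w, G.Adj u w ∧ G.Adj w v := by
  obtain ⟨p⟩ := h
  induction p with
  | nil => exact Or.inl rfl
  | @cons x y z hxy p ih =>
    rcases ih with rfl | hyz | ⟨w, hyw, hwz⟩
    · exact Or.inr (Or.inl hxy)
    · exact Or.inr (Or.inr ⟨y, hxy, hyz⟩)
    · rcases hG x y w z hxy hyw hwz with h | h | h
      · exact Or.inr (Or.inr ⟨w, h, hwz⟩)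
      · exact Or.inr (Or.inr ⟨y, hxy, h⟩)
      · exact Or.inr (Or.inl h)

theorem P4Free.diamTwo_supp (hG : G.P4Free) (c : G.ConnectedComponent) : G.DiamTwo c.supp := by
  intro x hx y hy hxy hadj
  have hr : G.Reachable x y := ConnectedComponent.eq.1 (hx.trans hy.symm)
  obtain ⟨w, hxw, hwy⟩ := ((hG.reachable hr).resolve_left hxy).resolve_left hadj
  exact ⟨w, (ConnectedComponent.sound hxw.symm.reachable).trans hx, hxw, hwy⟩

theorem ClusterOn.exists_not_adj (h : G.ClusterOn B) {b b' y : V} (hb : b ∈ B) (hb' : b' ∈ B)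
    (hne : b ≠ b') (hbb : ¬ G.Adj b b') (hy : y ∈ B) : ∃ x ∈ B, x ≠ y ∧ ¬ G.Adj x y := by
  by_cases h1 : b = y
  · exact ⟨b', hb', fun e => hne (h1.trans e.symm), fun e => hbb (h1 ▸ e.symm)⟩
  by_cases h2 : G.Adj b y
  · refine ⟨b', hb', fun e => hbb (e ▸ h2), fun e => hbb ?_⟩
    exact h b hb y hy b' hb' h2 e.symm hne
  · exact ⟨b, hb, h1, h2⟩

/-- In a connected cograph split into an edgeless set and a cluster which is not a clique, the
two sides are completely joined. -/
theorem P4Free.complete_of_not_clique (hG : G.P4Free) (hS : G.DiamTwo S)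
    (hA : G.Edgeless (S ∩ A)) (hB : G.ClusterOn (S \ A)) {b b' : V} (hb : b ∈ S \ A)
    (hb' : b' ∈ S \ A) (hne : b ≠ b') (hbb : ¬ G.Adj b b') :
    ∀ a ∈ S ∩ A, ∀ y ∈ S \ A, G.Adj a y := by
  intro a ha y hy
  by_contra hay
  obtain ⟨w, hw, haw, hwy⟩ := hS a ha.1 y hy.1 (fun e => hy.2 (e ▸ ha.2)) hay
  have hwB : w ∈ S \ A := ⟨hw, fun h => hA a ha w ⟨hw, h⟩ haw⟩
  -- Here x lies in a clique other than that of w and y; if a were adjacent to x, then x, a, w, y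
  -- would induce a P₄.
  obtain ⟨x, hx, hxy, hxy'⟩ := hB.exists_not_adj hb hb' hne hbb hy
  have hxw : x ≠ w := fun e => hxy' (e ▸ hwy)
  have hxw' : ¬ G.Adj x w := fun h => hxy' (hB x hx w hwB y hy h hwy hxy)
  have hax : ¬ G.Adj a x := by
    intro h
    rcases hG x a w y h.symm haw hwy with h | h | h
    exacts [hxw' h, hay h, hxy' h]
  -- A common neighbour a' of w and x lies in A, as w and x are in different cliques; then a, w, a',
  -- x induce a P₄.
  obtain ⟨a', ha', hwa, hax'⟩ := hS w hw x hx.1 hxw.symm (fun h => hxw' h.symm)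
  have haA : a' ∈ A := by
    by_contra h
    exact hxw' (hB w hwB a' ⟨ha', h⟩ x hx hwa hax' hxw.symm).symm
  rcases hG a w a' x haw hwa hax' with h | h | h
  exacts [hA a ha a' ⟨ha', haA⟩ h, hxw' h.symm, hax h]

/-- A connected cograph of finite monopolar number at least two is the join of an edgeless graph
and a cluster with that number of components. -/
theorem P4Free.exists_join (hG : G.P4Free) (hS : G.DiamTwo S) (hm : G.Monopolar S)
    (h2 : 2 ≤ G.monoNumber S) :
    ∃ A, G.Edgeless (S ∩ A) ∧ G.ClusterColorable (S \ A) (G.monoNumber S) ∧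
      (∀ a ∈ S ∩ A, ∀ y ∈ S \ A, G.Adj a y) ∧ (∃ a, a ∈ S ∩ A) ∧
      ∃ b ∈ S \ A, ∃ b' ∈ S \ A, b ≠ b' ∧ ¬ G.Adj b b' := by
  obtain ⟨A, hA, hB⟩ := hm.monopolarOn
  have hcl := hB.clusterOn
  obtain ⟨b, hb, b', hb', hne, hbb⟩ : ∃ b ∈ S \ A, ∃ b' ∈ S \ A, b ≠ b' ∧ ¬ G.Adj b b' := by
    by_contra! h
    have : G.MonopolarOn S 1 := ⟨A, hA, clusterColorable_of_clique h⟩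
    have := this.monoNumber_le
    omega
  refine ⟨A, hA, hB, hG.complete_of_not_clique hS hA hcl hb hb' hne hbb, ?_,
    b, hb, b', hb', hne, hbb⟩
  obtain ⟨w, hw, hbw, hwb⟩ := hS b hb.1 b' hb'.1 hne hbb
  refine ⟨w, hw, ?_⟩
  by_contra hwA
  exact hbb (hcl b hb w ⟨hw, hwA⟩ b' hb' hbw hwb hne)

/-- The component of v uses at least one of the k colours, and `ClusterColorable.split` leaves the
others to the rest. -/
theorem ClusterColorable.remove_component [Finite V] (h : G.ClusterColorable B k) (hv : v ∈ B) :
    G.ClusterColorable {x ∈ B | x ≠ v ∧ ¬ G.Adj v x} (k - 1) := by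
  have hcl := h.clusterOn
  have hB : B = {x ∈ B | x = v ∨ G.Adj v x} ∪ {x ∈ B | x ≠ v ∧ ¬ G.Adj v x} := by
    ext x; simp only [Set.mem_union, Set.mem_ofPred_eq]; tauto
  rw [hB] at h
  have hdis : Disjoint {x ∈ B | x = v ∨ G.Adj v x} {x ∈ B | x ≠ v ∧ ¬ G.Adj v x} := by
    rw [Set.disjoint_left]; rintro x ⟨_, h⟩ ⟨_, h1, h2⟩; exact h.elim h1 h2
  obtain ⟨i, j, hij, ⟨c, hc, -⟩, hj⟩ := h.split hdis <| by
    rintro x ⟨hx, h⟩ y ⟨hy, hyv, hvy⟩ hxy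
    rcases h with rfl | h
    · exact hvy hxy
    · exact hvy (hcl v hv x hx y hy h hxy hyv.symm)
  have := hc v ⟨hv, Or.inl rfl⟩
  exact hj.mono subset_rfl (by omega)

/-- A connected cograph of finite monopolar number `m ≥ 2` is `(∞, m - 1)`-polar. -/
theorem P4Free.polarOn_pred [Finite V] (hG : G.P4Free) (hS : G.DiamTwo S) (hm : G.Monopolar S)
    (h2 : 2 ≤ G.monoNumber S) : G.PolarOn S (G.monoNumber S - 1) := by
  obtain ⟨A, hA, hB, hAB, -, b, hb, -⟩ := hG.exists_join hS hm h2
  have hcl := hB.clusterOn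
  -- Move the clique of b to A: since A is joined to it, the result is complete multipartite, with A
  -- as one part and the clique vertices as singletons.
  refine ⟨A ∪ {x | x = b ∨ G.Adj b x}, ?_, (hB.remove_component hb).mono ?_ le_rfl⟩
  · have hK : ∀ x ∈ S \ A, (x = b ∨ G.Adj b x) → ∀ y ∈ S \ A, (y = b ∨ G.Adj b y) →
        ¬ G.Adj x y → x = y := by
      rintro x hx (rfl | hbx) y hy (rfl | hby) hxy
      · rfl
      · exact absurd hby hxy
      · exact absurd hbx.symm hxy
      · by_contra hne
        exact hxy (hcl x hx b hb y hy hbx.symm hby hne)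
    rintro x ⟨hxS, hx⟩ y ⟨hyS, hy⟩ z ⟨hzS, hz⟩ hxy hyz
    by_cases hyA : y ∈ A
    · have hxA : x ∈ A := by
        by_contra h
        exact hxy (hAB y ⟨hyS, hyA⟩ x ⟨hxS, h⟩).symm
      have hzA : z ∈ A := by
        by_contra h
        exact hyz (hAB y ⟨hyS, hyA⟩ z ⟨hzS, h⟩)
      exact hA x ⟨hxS, hxA⟩ z ⟨hzS, hzA⟩
    · have hxA : x ∉ A := fun h => hxy (hAB x ⟨hxS, h⟩ y ⟨hyS, hyA⟩)
      have := hK x ⟨hxS, hxA⟩ (hx.resolve_left hxA) y ⟨hyS, hyA⟩ (hy.resolve_left hyA) hxy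
      rwa [this]
  · rintro x ⟨hxS, hx⟩
    simp only [Set.mem_union, Set.mem_ofPred_eq, not_or] at hx
    exact ⟨⟨hxS, hx.1⟩, hx.2⟩

/-- In a cluster S - u, a surviving vertex x of the cluster side forces S ∩ A to be a single vertex
a, and a forces the cluster side without u to be a clique. Thus S - u is a clique, and {u} on the
edgeless side gives m(S) ≤ 1. -/
theorem not_clusterOn_diff_singleton (hm : 2 ≤ G.monoNumber S) (hA : G.Edgeless (S ∩ A))
    (hB : G.ClusterOn (S \ A)) (hAB : ∀ a ∈ S ∩ A, ∀ y ∈ S \ A, G.Adj a y)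
    (ha : ∃ a, a ∈ S ∩ A) {b b' : V} (hb : b ∈ S \ A) (hb' : b' ∈ S \ A) (hne : b ≠ b')
    (hbb : ¬ G.Adj b b') (hu : u ∈ S \ A) : ¬ G.ClusterOn (S \ {u}) := by
  intro hcl
  obtain ⟨a, ha⟩ := ha
  obtain ⟨x, hx, hxu, hxu'⟩ := hB.exists_not_adj hb hb' hne hbb hu
  have hau : ∀ a ∈ S ∩ A, a ≠ u := fun a ha e => hu.2 (e ▸ ha.2)
  have haa : ∀ a' ∈ S ∩ A, a' = a := by
    intro a' ha'
    by_contra hne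
    exact hA a' ha' a ha (hcl a' ⟨ha'.1, hau a' ha'⟩ x ⟨hx.1, hxu⟩ a ⟨ha.1, hau a ha⟩
      (hAB a' ha' x hx) (hAB a ha x hx).symm hne)
  have hclq : ∀ y ∈ S \ A, y ≠ u → ∀ z ∈ S \ A, z ≠ u → y ≠ z → G.Adj y z :=
    fun y hy hyu z hz hzu hyz => hcl y ⟨hy.1, hyu⟩ a ⟨ha.1, hau a ha⟩ z ⟨hz.1, hzu⟩
      (hAB a ha y hy).symm (hAB a ha z hz) hyz
  have : G.MonopolarOn S 1 := by
    refine ⟨{u}, ?_, clusterColorable_of_clique ?_⟩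
    · rintro _ ⟨_, rfl⟩ _ ⟨_, rfl⟩ h; exact h.ne rfl
    · rintro y ⟨hy, hyu⟩ z ⟨hz, hzu⟩ hyz
      by_cases hyA : y ∈ A
      · have hzA : z ∉ A := fun h => hyz ((haa y ⟨hy, hyA⟩).trans (haa z ⟨hz, h⟩).symm)
        exact hAB y ⟨hy, hyA⟩ z ⟨hz, hzA⟩
      · by_cases hzA : z ∈ A
        · exact (hAB z ⟨hz, hzA⟩ y ⟨hy, hyA⟩).symm
        · exact hclq y ⟨hy, hyA⟩ hyu z ⟨hz, hzA⟩ hzu hyz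
  have := this.monoNumber_le
  omega

/-- A connected cograph of finite monopolar number at least two has a vertex whose deletion
lowers that number by at most one and leaves a graph which is not a cluster. -/
theorem P4Free.exists_monoNumber_le_succ [Finite V] (hG : G.P4Free) (hS : G.DiamTwo S)
    (hm : G.Monopolar S) (h2 : 2 ≤ G.monoNumber S) :
    ∃ u ∈ S, G.monoNumber S ≤ G.monoNumber (S \ {u}) + 1 ∧ ¬ G.ClusterOn (S \ {u}) := by
  obtain ⟨A, hA, hB, hAB, ha, b, hb, b', hb', hne, hbb⟩ := hG.exists_join hS hm h2
  have hcl := hB.clusterOn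
  suffices ∃ u ∈ S \ A, G.monoNumber S ≤ G.monoNumber (S \ {u}) + 1 by
    obtain ⟨u, hu, hu'⟩ := this
    exact ⟨u, hu.1, hu', not_clusterOn_diff_singleton h2 hA hcl hAB ha hb hb' hne hbb hu⟩
  by_cases hiso : G.NoIsolatedOn (S \ A)
  · refine ⟨b, hb, ?_⟩
    have hmB := hm.mono (Set.sdiff_subset (t := A))
    -- Without isolated vertices in the cluster side, m(S) ≤ m(S \ A) ≤ m(S \ A - b) + 1 ≤ m(S - b)
    -- + 1.
    have h1 : G.monoNumber S ≤ G.monoNumber (S \ A) := MonopolarOn.monoNumber_le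
      ⟨A, hA, hcl.clusterColorable_of_monopolarOn hiso hmB.monopolarOn⟩
    have h2 := hmB.monoNumber_le_diff_singleton (hcl.closed_twin hb)
    have h3 : G.monoNumber ((S \ A) \ {b}) ≤ G.monoNumber (S \ {b}) :=
      (hm.mono Set.sdiff_subset).monoNumber_mono (Set.sdiff_subset_sdiff_left Set.sdiff_subset)
    omega
  · simp only [NoIsolatedOn] at hiso
    push Not at hiso
    obtain ⟨u, hu, hiso⟩ := hiso
    refine ⟨u, hu, ?_⟩
    have hmu := hm.mono (Set.sdiff_subset (t := {u}))
    obtain ⟨A', hA', hB'⟩ := hmu.monopolarOn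
    have hcl' := hB'.clusterOn
    have hau : ∀ a ∈ S ∩ A, a ≠ u := fun a ha e => hu.2 (e ▸ ha.2)
    -- Now u has neighbours only in A. If an optimal A' for S - u misses A, then u can be added to
    -- A' for free; if it contains S ∩ A, then u becomes a new component.
    by_cases hc1 : ∀ a ∈ S ∩ A, a ∉ A'
    · have : G.MonopolarOn S (G.monoNumber (S \ {u})) := by
        refine ⟨insert u A', ?_, hB'.mono ?_ le_rfl⟩
        · have hux : ∀ x ∈ S, x ∈ A' → ¬ G.Adj u x := fun x hx hxA' h =>
            hiso x ⟨hx, fun hxA => hc1 x ⟨hx, hxA⟩ hxA'⟩ h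
          rintro x ⟨hx, hxA⟩ y ⟨hy, hyA⟩ hxy
          rcases hxA with rfl | hxA
          · exact hux y hy (hyA.resolve_left hxy.ne') hxy
          · rcases hyA with rfl | hyA
            · exact hux x hx hxA hxy.symm
            · by_cases hxu : x = u
              · subst hxu; exact hux y hy hyA hxy
              · by_cases hyu : y = u
                · subst hyu; exact hux x hx hxA hxy.symm
                · exact hA' x ⟨⟨hx, hxu⟩, hxA⟩ y ⟨⟨hy, hyu⟩, hyA⟩ hxy
        · rintro x ⟨hx, hxA⟩
          exact ⟨⟨hx, fun h => hxA (Or.inl h)⟩, fun h => hxA (Or.inr h)⟩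
      have := this.monoNumber_le
      omega
    by_cases hc2 : ∀ a ∈ S ∩ A, a ∈ A'
    · refine MonopolarOn.monoNumber_le ⟨A' \ {u}, hA'.mono ?_, (hB'.insert_new (v := u) ?_).mono
        ?_ le_rfl⟩
      · rintro x ⟨hx, hxA, hxu⟩; exact ⟨⟨hx, hxu⟩, hxA⟩
      · rintro x ⟨⟨hx, hxu⟩, hxA⟩ h
        exact hiso x ⟨hx, fun h => hxA (hc2 x ⟨hx, h⟩)⟩ h
      · rintro x ⟨hx, hxA⟩
        by_cases hxu : x = u
        · exact Or.inl hxu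
        · exact Or.inr ⟨⟨hx, hxu⟩, fun h => hxA ⟨h, hxu⟩⟩
    -- Mixed case: a₂ ∈ A' keeps the old cluster side out of A', and a₁ ∉ A' then makes it a clique
    -- apart from u. So m(S) ≤ 2, while S - u still has an edge.
    push Not at hc1 hc2
    obtain ⟨a₂, ha₂, ha₂'⟩ := hc1
    obtain ⟨a₁, ha₁, ha₁'⟩ := hc2
    have hyA' : ∀ y ∈ S \ A, y ≠ u → y ∉ A' := fun y hy hyu hyA' =>
      hA' a₂ ⟨⟨ha₂.1, hau a₂ ha₂⟩, ha₂'⟩ y ⟨⟨hy.1, hyu⟩, hyA'⟩ (hAB a₂ ha₂ y hy)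
    have h2' : G.MonopolarOn S 2 := by
      refine ⟨A, hA, ((clusterColorable_of_clique (B := (S \ A) \ {u}) ?_).insert_new
        (v := u) ?_).mono ?_ le_rfl⟩
      · rintro y ⟨hy, hyu⟩ z ⟨hz, hzu⟩ hyz
        exact hcl' y ⟨⟨hy.1, hyu⟩, hyA' y hy hyu⟩ a₁ ⟨⟨ha₁.1, hau a₁ ha₁⟩, ha₁'⟩ z
          ⟨⟨hz.1, hzu⟩, hyA' z hz hzu⟩ (hAB a₁ ha₁ y hy).symm (hAB a₁ ha₁ z hz) hyz
      · rintro y ⟨hy, -⟩; exact hiso y hy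
      · intro x hx
        by_cases hxu : x = u
        · exact Or.inl hxu
        · exact Or.inr ⟨hx, hxu⟩
    have := h2'.monoNumber_le
    obtain ⟨x, hx, hxu, -⟩ := hcl.exists_not_adj hb hb' hne hbb hu
    have := hmu.monoNumber_pos ⟨ha₁.1, hau a₁ ha₁⟩ ⟨hx.1, hxu⟩ (hAB a₁ ha₁ x hx)
    omega

variable (G) in
/-- `S` induces `K₁ ⊕ 2K₂`. -/
def ButterflyOn (S : Set V) : Prop :=
  ∃ z a₁ a₂ b₁ b₂, S = {z, a₁, a₂, b₁, b₂} ∧ G.Adj z a₁ ∧ G.Adj z a₂ ∧ G.Adj z b₁ ∧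
    G.Adj z b₂ ∧ G.Adj a₁ a₂ ∧ G.Adj b₁ b₂ ∧ ¬ G.Adj a₁ b₁ ∧ ¬ G.Adj a₁ b₂ ∧ ¬ G.Adj a₂ b₁ ∧
    ¬ G.Adj a₂ b₂ ∧ a₁ ≠ b₁ ∧ a₁ ≠ b₂ ∧ a₂ ≠ b₁ ∧ a₂ ≠ b₂

theorem ClusterOn.exists_two_edges (hB : G.ClusterOn B)
    (h2 : 2 ≤ G.monoNumber B) : ∃ p ∈ B, ∃ q ∈ B, ∃ r ∈ B, ∃ s ∈ B, G.Adj p q ∧ G.Adj r s ∧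
      ¬ G.Adj p r ∧ ¬ G.Adj p s ∧ ¬ G.Adj q r ∧ ¬ G.Adj q s ∧ p ≠ r ∧ p ≠ s ∧ q ≠ r ∧ q ≠ s := by
  have : ¬ G.Edgeless B := by
    intro h
    have : G.MonopolarOn B 0 := ⟨B, h.mono (by simp), by simpa using clusterColorable_empty⟩
    have := this.monoNumber_le
    omega
  simp only [Edgeless] at this
  push Not at this
  obtain ⟨p, hp, q, hq, hpq⟩ := this
  obtain ⟨r, hr, s, hs, hrs, hpr, hpr'⟩ : ∃ r ∈ B, ∃ s ∈ B, G.Adj r s ∧ p ≠ r ∧ ¬ G.Adj p r := by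
    by_contra! h
    -- If the component of p contained all edges, the vertices outside it would be edgeless, giving
    -- m(B) ≤ 1.
    have : G.MonopolarOn B 1 := by
      refine ⟨{r | p ≠ r ∧ ¬ G.Adj p r}, ?_, clusterColorable_of_clique ?_⟩
      · rintro x ⟨hx, h1, h2⟩ y ⟨hy, -⟩ hxy
        exact h2 (h x hx y hy hxy h1)
      · rintro x ⟨hx, hx'⟩ y ⟨hy, hy'⟩ hxy
        simp only [Set.mem_ofPred_eq, not_and, not_not] at hx' hy'
        by_cases hpx : p = x
        · subst hpx; exact hy' hxy
        · by_cases hpy : p = y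
          · subst hpy; exact (hx' hpx).symm
          · exact hB x hx p hp y hy (hx' hpx).symm (hy' hpy) hxy
    have := this.monoNumber_le
    omega
  have hps : p ≠ s := fun e => hpr' (e ▸ hrs.symm)
  have hps' : ¬ G.Adj p s := fun h => hpr' (hB p hp s hs r hr h hrs.symm hpr)
  have hqr : q ≠ r := fun e => hpr' (e ▸ hpq)
  have hqs : q ≠ s := fun e => hps' (e ▸ hpq)
  exact ⟨p, hp, q, hq, r, hr, s, hs, hpq, hrs, hpr', hps',
    fun h => hpr' (hB p hp q hq r hr hpq h hpr),
    fun h => hps' (hB p hp q hq s hs hpq h hps), hpr, hps, hqr, hqs⟩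

/-- A connected cograph of finite monopolar number at least two, in which deleting a vertex lowers
that number or leaves a cluster, induces `K₁ ⊕ 2K₂` if some deletion does not lower the number. -/
theorem P4Free.butterflyOn (hG : G.P4Free) (hS : G.DiamTwo S) (hm : G.Monopolar S)
    (h2 : 2 ≤ G.monoNumber S)
    (hcrit : ∀ u ∈ S, G.monoNumber (S \ {u}) < G.monoNumber S ∨ G.ClusterOn (S \ {u}))
    (hu : u ∈ S) (hmu : G.monoNumber S ≤ G.monoNumber (S \ {u})) : G.ButterflyOn S := by
  obtain ⟨A, hA, hB, hAB, ha, b, hb, b', hb', hne, hbb⟩ := hG.exists_join hS hm h2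
  have hcl := hB.clusterOn
  have hclu : G.ClusterOn (S \ {u}) := (hcrit u hu).resolve_left (by omega)
  have huA : u ∈ A := by
    by_contra h
    exact not_clusterOn_diff_singleton h2 hA hcl hAB ha hb hb' hne hbb ⟨hu, h⟩ hclu
  -- A second vertex of A would survive in the cluster S - u as a common neighbour of the
  -- nonadjacent b and b'. Hence S is u joined to a cluster.
  have hAu : ∀ a ∈ S ∩ A, a = u := by
    intro a ha
    by_contra hau
    exact hbb (hclu b ⟨hb.1, fun e => hb.2 (e ▸ huA)⟩ a ⟨ha.1, hau⟩ b'
      ⟨hb'.1, fun e => hb'.2 (e ▸ huA)⟩ (hAB a ha b hb).symm (hAB a ha b' hb') hne)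
  have hSA : S \ {u} ⊆ S \ A := fun x hx => ⟨hx.1, fun h => hx.2 (hAu x ⟨hx.1, h⟩)⟩
  have hux : ∀ x ∈ S \ {u}, G.Adj u x := fun x hx => hAB u ⟨hu, huA⟩ x (hSA hx)
  obtain ⟨p, hp, q, hq, r, hr, s, hs, hpq, hrs, hpr, hps, hqr, hqs, npr, nps, nqr, nqs⟩ :=
    hclu.exists_two_edges (h2.trans hmu)
  refine ⟨u, p, q, r, s, ?_, hux p hp, hux q hq, hux r hr, hux s hs, hpq, hrs, hpr, hps, hqr,
    hqs, npr, nps, nqr, nqs⟩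
  refine Set.Subset.antisymm (fun v hv => ?_) ?_
  swap
  · rintro x (rfl | rfl | rfl | rfl | rfl)
    exacts [hu, hp.1, hq.1, hr.1, hs.1]
  -- Suppose there is a sixth vertex v. The path p, u, r survives its deletion, so m(S - v) < m(S);
  -- the aim is m(S - u) ≤ m(S - v).
  by_contra hvne
  simp only [Set.mem_insert_iff, Set.mem_singleton_iff, not_or] at hvne
  obtain ⟨hvu, hvp, hvq, hvr, hvs⟩ := hvne
  have huv : u ∈ S \ {v} := ⟨hu, Ne.symm hvu⟩
  have hpv : p ∈ S \ {v} := ⟨hp.1, Ne.symm hvp⟩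
  have hqv : q ∈ S \ {v} := ⟨hq.1, Ne.symm hvq⟩
  have hrv : r ∈ S \ {v} := ⟨hr.1, Ne.symm hvr⟩
  have hsv : s ∈ S \ {v} := ⟨hs.1, Ne.symm hvs⟩
  have hlt : G.monoNumber (S \ {v}) < G.monoNumber S := by
    refine (hcrit v hv).resolve_right fun h => hpr ?_
    exact h p hpv u huv r hrv (hux p hp).symm (hux r hr) npr
  obtain ⟨A', hA', hB'⟩ := (hm.mono (Set.sdiff_subset (t := {v}))).monopolarOn
  have hcl' := hB'.clusterOn
  -- Otherwise the cluster side would be a clique around u, although it contains an end of each of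
  -- the edges pq and rs.
  have huA' : u ∈ A' := by
    by_contra huA'
    have key : ∀ x y, x ∈ S \ {u} → y ∈ S \ {u} → x ∈ S \ {v} → y ∈ S \ {v} → x ∉ A' → y ∉ A' →
        x ≠ y → G.Adj x y := fun x y hx hy hxv hyv hxA hyA hxy =>
      hcl' x ⟨hxv, hxA⟩ u ⟨huv, huA'⟩ y ⟨hyv, hyA⟩ (hux x hx).symm (hux y hy) hxy
    by_cases hpA : p ∈ A'
    · have hqA : q ∉ A' := fun h => hA' p ⟨hpv, hpA⟩ q ⟨hqv, h⟩ hpq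
      by_cases hrA : r ∈ A'
      · exact hqs (key q s hq hs hqv hsv hqA (fun h => hA' r ⟨hrv, hrA⟩ s ⟨hsv, h⟩ hrs) nqs)
      · exact hqr (key q r hq hr hqv hrv hqA hrA nqr)
    · by_cases hrA : r ∈ A'
      · exact hps (key p s hp hs hpv hsv hpA (fun h => hA' r ⟨hrv, hrA⟩ s ⟨hsv, h⟩ hrs) nps)
      · exact hpr (key p r hp hr hpv hrv hpA hrA npr)
  have hBv : G.ClusterColorable ((S \ {u}) \ {v}) (G.monoNumber (S \ {v})) := by
    refine hB'.mono ?_ le_rfl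
    rintro x ⟨hx, hxv⟩
    exact ⟨⟨hx.1, hxv⟩, fun h => hA' u ⟨huv, huA'⟩ x ⟨⟨hx.1, hxv⟩, h⟩ (hux x hx)⟩
  have hvB : v ∈ S \ {u} := ⟨hv, hvu⟩
  -- The vertex v returns without a new colour: as a closed twin of a neighbour, or, when isolated
  -- in S - u, alone on the edgeless side.
  have : G.MonopolarOn (S \ {u}) (G.monoNumber (S \ {v})) := by
    by_cases hiso : ∃ w ∈ S \ {u}, G.Adj v w
    · obtain ⟨w, hw, hvw⟩ := hiso
      refine ((hBv.insert_twin ⟨hw, hvw.ne'⟩ hvw ?_).mono ?_ le_rfl).monopolarOn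
      · exact fun b hb => hclu.closed_twin hvB w hw hvw b hb.1
      · simp
    · push Not at hiso
      refine ⟨{v}, ?_, hBv⟩
      rintro _ ⟨_, rfl⟩ _ ⟨_, rfl⟩ h; exact h.ne rfl
  have := this.monoNumber_le
  omega

end Connected

/-! ### Transfer between vertex subsets, induced subgraphs and the given definitions; copies of K₂.
-/

section Transfer

variable {V W : Type*} {G : SimpleGraph V} {H : SimpleGraph W} {A B S : Set V} {T U : Set W}
  {k n : ℕ}

theorem isCograph_iff_p4Free : G.IsCograph ↔ G.P4Free := by
  constructor
  · intro h a b c d hab hbc hcd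
    by_contra! hn
    obtain ⟨hac, hbd, had⟩ := hn
    have nac : a ≠ c := by rintro rfl; exact had hcd
    have nbd : b ≠ d := by rintro rfl; exact had hab
    have nad : a ≠ d := by rintro rfl; exact hac hcd.symm
    refine h ⟨⟨⟨![a, b, c, d], ?_⟩, ?_⟩⟩
    · intro i j hij
      fin_cases i <;> fin_cases j <;>
        simp_all [hab.ne, hbc.ne, hcd.ne, hab.ne', hbc.ne', hcd.ne']
    · intro i j
      change G.Adj (![a, b, c, d] i) (![a, b, c, d] j) ↔ _
      fin_cases i <;> fin_cases j <;>
        simp [pathGraph_adj, hab, hbc, hcd, hac, hbd, had, hab.symm, hbc.symm, hcd.symm,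
          G.adj_comm c a, G.adj_comm d b, G.adj_comm d a]
  · rintro h ⟨f⟩
    have hf : ∀ i j, G.Adj (f i) (f j) ↔ (pathGraph 4).Adj i j := fun i j => f.map_adj_iff
    have := h (f 0) (f 1) (f 2) (f 3)
    simp [hf, pathGraph_adj] at this

theorem P4Free.comap (h : G.P4Free) (φ : H ↪g G) : H.P4Free := by
  intro a b c d hab hbc hcd
  simpa using h (φ a) (φ b) (φ c) (φ d) (by simpa) (by simpa) (by simpa)

theorem P4Free.sum (hG : G.P4Free) (hH : H.P4Free) : (G ⊕g H).P4Free := by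
  rintro (a | a) (b | b) (c | c) (d | d) hab hbc hcd <;> simp_all
  · exact hG a b c d hab hbc hcd
  · exact hH a b c d hab hbc hcd

theorem edgeless_image (φ : H ↪g G) : G.Edgeless (φ '' T) ↔ H.Edgeless T := by
  simp [Edgeless]

theorem clusterOn_image (φ : H ↪g G) : G.ClusterOn (φ '' T) ↔ H.ClusterOn T := by
  simp [ClusterOn]

theorem multipartiteOn_image (φ : H ↪g G) : G.MultipartiteOn (φ '' T) ↔ H.MultipartiteOn T := by
  simp [MultipartiteOn]

theorem anticomplete_image (φ : H ↪g G) :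
    G.Anticomplete (φ '' T) (φ '' U) ↔ H.Anticomplete T U := by
  simp [Anticomplete]

theorem clusterColorable_image (φ : H ↪g G) :
    G.ClusterColorable (φ '' T) k ↔ H.ClusterColorable T k := by
  constructor
  · rintro ⟨c, hc, h⟩
    refine ⟨c ∘ φ, fun x hx => hc _ ⟨x, hx, rfl⟩, fun x hx y hy hxy => ?_⟩
    simpa using h _ ⟨x, hx, rfl⟩ _ ⟨y, hy, rfl⟩ (φ.injective.ne hxy)
  · rintro ⟨c, hc, h⟩
    have he : ∀ x, Function.extend φ c 0 (φ x) = c x := φ.injective.extend_apply c 0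
    refine ⟨Function.extend φ c 0, ?_, ?_⟩
    · rintro _ ⟨x, hx, rfl⟩; rw [he]; exact hc x hx
    · rintro _ ⟨x, hx, rfl⟩ _ ⟨y, hy, rfl⟩ hxy
      rw [he, he, φ.map_adj_iff]
      exact h x hx y hy fun e => hxy (e ▸ rfl)

theorem monopolarOn_image (φ : H ↪g G) : G.MonopolarOn (φ '' T) k ↔ H.MonopolarOn T k := by
  constructor
  · rintro ⟨A, hA, hB⟩
    refine ⟨φ ⁻¹' A, ?_, ?_⟩
    · rwa [← edgeless_image φ, Set.image_inter_preimage]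
    · rwa [← clusterColorable_image φ, Set.image_sdiff_preimage]
  · rintro ⟨A, hA, hB⟩
    refine ⟨φ '' A, ?_, ?_⟩
    · rwa [← Set.image_inter φ.injective, edgeless_image]
    · rwa [← Set.image_sdiff φ.injective, clusterColorable_image]

theorem polarOn_image (φ : H ↪g G) : G.PolarOn (φ '' T) k ↔ H.PolarOn T k := by
  constructor
  · rintro ⟨A, hA, hB⟩
    refine ⟨φ ⁻¹' A, ?_, ?_⟩
    · rwa [← multipartiteOn_image φ, Set.image_inter_preimage]
    · rwa [← clusterColorable_image φ, Set.image_sdiff_preimage]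
  · rintro ⟨A, hA, hB⟩
    refine ⟨φ '' A, ?_, ?_⟩
    · rwa [← Set.image_inter φ.injective, multipartiteOn_image]
    · rwa [← Set.image_sdiff φ.injective, clusterColorable_image]

theorem monopolar_image (φ : H ↪g G) : G.Monopolar (φ '' T) ↔ H.Monopolar T := by
  simp [Monopolar, monopolarOn_image]

theorem monoNumber_image (φ : H ↪g G) : G.monoNumber (φ '' T) = H.monoNumber T := by
  simp [monoNumber, monopolarOn_image]

theorem ClusterOn.adj_of_reachable (h : G.ClusterOn Set.univ) {x y : V} (hr : G.Reachable x y)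
    (hxy : x ≠ y) : G.Adj x y := by
  obtain ⟨p⟩ := hr
  induction p with
  | nil => exact absurd rfl hxy
  | @cons x y z hadj p ih =>
    by_cases hyz : y = z
    · exact hyz ▸ hadj
    · exact h x trivial y trivial z trivial hadj (ih hyz) hxy

theorem isCluster_iff : G.IsCluster ↔ G.ClusterOn Set.univ := by
  constructor
  · intro h x _ y _ z _ hxy hyz hxz
    have := h.trans x y z (by simp [hxy]) (by simp [hyz])
    simpa [hxz] using this
  · intro h
    refine ⟨fun x y z hxy hyz => ?_⟩
    simp only [compl_adj, not_and, not_not] at *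
    intro hxz
    by_cases h1 : x = y
    · subst h1; exact hyz hxz
    · by_cases h2 : y = z
      · subst h2; exact hxy hxz
      · exact h x trivial y trivial z trivial (hxy h1) (hyz h2) hxz

theorem isClusterAtMost_iff [Finite V] :
    G.IsClusterAtMost k ↔ G.ClusterColorable Set.univ k := by
  rw [IsClusterAtMost, isCluster_iff, ENat.card_eq_coe_natCard, Nat.cast_le]
  constructor
  · rintro ⟨h, hk⟩
    refine (clusterColorable_of_map G.connectedComponentMk ?_).mono subset_rfl (le_trans ?_ hk)
    · intro x _ y _ hxy
      exact ⟨fun h => ConnectedComponent.sound h.reachable,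
        fun he => h.adj_of_reachable (ConnectedComponent.eq.1 he) hxy⟩
    · rw [← Nat.card_coe_set_eq]
      exact Nat.card_mono Set.finite_univ (Set.subset_univ _) |>.trans (by simp)
  · intro h
    refine ⟨h.clusterOn, ?_⟩
    obtain ⟨c, hc, h⟩ := h
    let f : G.ConnectedComponent → Fin k := fun C => ⟨c C.exists_rep.choose, hc _ trivial⟩
    have hf : Function.Injective f := by
      intro C D hCD
      have hcd : c C.exists_rep.choose = c D.exists_rep.choose := congrArg Fin.val hCD
      rw [← C.exists_rep.choose_spec, ← D.exists_rep.choose_spec]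
      by_cases he : C.exists_rep.choose = D.exists_rep.choose
      · rw [he]
      · exact ConnectedComponent.sound ((h _ trivial _ trivial he).2 hcd).reachable
    simpa using Nat.card_le_card_of_injective f hf

theorem image_induce_univ : Embedding.induce (G := G) S '' Set.univ = S := by
  rw [Set.image_univ]; exact Subtype.range_coe

theorem induce_isClusterAtMost_iff [Finite V] :
    (G.induce B).IsClusterAtMost k ↔ G.ClusterColorable B k := by
  rw [isClusterAtMost_iff, ← clusterColorable_image (Embedding.induce B),
    image_induce_univ]

theorem induce_isCompleteMultipartiteAtMost_top_iff :
    (G.induce A).IsCompleteMultipartiteAtMost ⊤ ↔ G.MultipartiteOn A := by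
  constructor
  · rintro ⟨h, -⟩ x hx y hy z hz hxy hyz
    exact h.trans ⟨x, hx⟩ ⟨y, hy⟩ ⟨z, hz⟩ hxy hyz
  · intro h
    exact ⟨⟨fun x y z hxy hyz => h x x.2 y y.2 z z.2 hxy hyz⟩, le_top⟩

theorem induce_isCompleteMultipartiteAtMost_one_iff :
    (G.induce A).IsCompleteMultipartiteAtMost 1 ↔ G.Edgeless A := by
  constructor
  · rintro ⟨h, h1⟩ x hx y hy hxy
    have := (ENat.card_le_one_iff_subsingleton _).1 h1
    have he : (Quotient.mk h.setoid ⟨x, hx⟩) = Quotient.mk h.setoid ⟨y, hy⟩ :=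
      Subsingleton.elim _ _
    exact Quotient.exact he hxy
  · intro h
    refine ⟨⟨fun x y z _ _ => h x x.2 z z.2⟩, ?_⟩
    rw [ENat.card_le_one_iff_subsingleton]
    refine ⟨fun a b => ?_⟩
    induction a using Quotient.inductionOn
    induction b using Quotient.inductionOn
    rename_i a b
    exact Quotient.sound (h a a.2 b b.2)

theorem isPolar_one_iff [Finite V] : G.IsPolar 1 k ↔ G.MonopolarOn Set.univ k := by
  simp [IsPolar, MonopolarOn, induce_isClusterAtMost_iff,
    induce_isCompleteMultipartiteAtMost_one_iff, Set.compl_eq_univ_sdiff]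

theorem isPolar_top_iff [Finite V] : G.IsPolar ⊤ k ↔ G.PolarOn Set.univ k := by
  simp [IsPolar, PolarOn, induce_isClusterAtMost_iff,
    induce_isCompleteMultipartiteAtMost_top_iff, Set.compl_eq_univ_sdiff]

theorem induce_isPolar_one_iff [Finite V] : (G.induce S).IsPolar 1 k ↔ G.MonopolarOn S k := by
  rw [isPolar_one_iff, ← monopolarOn_image (Embedding.induce S),
    image_induce_univ]

theorem induce_isPolar_top_iff [Finite V] : (G.induce S).IsPolar ⊤ k ↔ G.PolarOn S k := by
  rw [isPolar_top_iff, ← polarOn_image (Embedding.induce S),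
    image_induce_univ]

theorem isPolar_one_top_iff [Finite V] : G.IsPolar 1 ⊤ ↔ G.Monopolar Set.univ := by
  constructor
  · rintro ⟨A, hA, hB, -⟩
    exact ⟨Nat.card (G.induce Aᶜ).ConnectedComponent,
      isPolar_one_iff.1 ⟨A, hA, hB, (ENat.card_eq_coe_natCard _).le⟩⟩
  · rintro ⟨k, h⟩
    obtain ⟨A, hA, hB, -⟩ := isPolar_one_iff.2 h
    exact ⟨A, hA, hB, le_top⟩

theorem forall_ne_univ_iff {P : Set V → Prop} (hP : ∀ S T, S ⊆ T → P T → P S) :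
    (∀ S, S ≠ Set.univ → P S) ↔ ∀ v, P (Set.univ \ {v}) := by
  constructor
  · exact fun h v => h _ fun e => (Set.eq_univ_iff_forall.1 e v).2 rfl
  · intro h S hS
    obtain ⟨v, hv⟩ := (Set.ne_univ_iff_exists_notMem S).1 hS
    exact hP S (Set.univ \ {v}) (fun x hx => ⟨trivial, fun e => hv (e ▸ hx)⟩) (h v)

theorem isCographMinObstruction_one_iff [Finite V] : G.IsCographMinObstruction 1 k ↔
    G.P4Free ∧ ¬ G.MonopolarOn Set.univ k ∧ ∀ v, G.MonopolarOn (Set.univ \ {v}) k := by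
  rw [IsCographMinObstruction, isCograph_iff_p4Free, isPolar_one_iff]
  simp only [induce_isPolar_one_iff]
  rw [forall_ne_univ_iff fun S T h hT => hT.mono h le_rfl]

theorem isCographMinObstruction_top_iff [Finite V] : G.IsCographMinObstruction ⊤ k ↔
    G.P4Free ∧ ¬ G.PolarOn Set.univ k ∧ ∀ v, G.PolarOn (Set.univ \ {v}) k := by
  rw [IsCographMinObstruction, isCograph_iff_p4Free, isPolar_top_iff]
  simp only [induce_isPolar_top_iff]
  rw [forall_ne_univ_iff fun S T h hT => hT.mono h le_rfl]

/-- Proper induced subgraphs are (1,k)-polar, hence (1,∞)-polar, so only the polarity of the whole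
graph is in question. -/
theorem IsCographMinObstruction.not_top_iff [Finite V] (h : G.IsCographMinObstruction 1 k) :
    ¬ G.IsCographMinObstruction 1 ⊤ ↔ G.Monopolar Set.univ := by
  rw [← isPolar_one_top_iff, not_iff_comm]
  constructor
  · intro hn
    refine ⟨h.1, hn, fun S hS => ?_⟩
    obtain ⟨A, hA, hB, -⟩ := h.2.2 S hS
    exact ⟨A, hA, hB, le_top⟩
  · exact fun h => h.2.1

theorem isIsomorphic_induce {f : W → V} (hf : Function.Injective f)
    (hadj : ∀ x y, G.Adj (f x) (f y) ↔ H.Adj x y) (hS : S = Set.range f) :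
    (G.induce S).IsIsomorphic H := by
  subst hS
  exact ⟨RelIso.symm ⟨Equiv.ofInjective f hf, by simp [hadj]⟩⟩

theorem isIsomorphic_of_bijective {f : W → V} (hf : Function.Bijective f)
    (hadj : ∀ x y, G.Adj (f x) (f y) ↔ H.Adj x y) : G.IsIsomorphic H :=
  ⟨RelIso.symm ⟨Equiv.ofBijective f hf, by simp [hadj]⟩⟩

theorem isIsomorphic_sum_induce (h : G.Anticomplete S Sᶜ) :
    G.IsIsomorphic (G.induce S ⊕g G.induce Sᶜ) := by
  refine isIsomorphic_of_bijective (f := Sum.elim Subtype.val Subtype.val) ⟨?_, ?_⟩ ?_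
  · rintro (⟨x, hx⟩ | ⟨x, hx⟩) (⟨y, hy⟩ | ⟨y, hy⟩) hxy
    · exact congrArg Sum.inl (Subtype.ext hxy)
    · obtain rfl : x = y := hxy; exact absurd hx hy
    · obtain rfl : x = y := hxy; exact absurd hy hx
    · exact congrArg Sum.inr (Subtype.ext hxy)
  · intro x
    by_cases hx : x ∈ S
    · exact ⟨Sum.inl ⟨x, hx⟩, rfl⟩
    · exact ⟨Sum.inr ⟨x, hx⟩, rfl⟩
  · rintro (⟨x, hx⟩ | ⟨x, hx⟩) (⟨y, hy⟩ | ⟨y, hy⟩)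
    · simp
    · simpa using h x hx y hy
    · simpa using h.symm x hx y hy
    · simp

variable (G) in
/-- `S` induces a disjoint union of copies of `K₂`. -/
def MatchingOn (S : Set V) : Prop := ∀ x ∈ S, ∃ y ∈ S, G.Adj x y ∧ ∀ z ∈ S, G.Adj x z → z = y

theorem MatchingOn.noIsolatedOn (h : G.MatchingOn S) : G.NoIsolatedOn S := fun x hx =>
  let ⟨y, hy, hxy, _⟩ := h x hx
  ⟨y, hy, hxy⟩

theorem MatchingOn.clusterOn (h : G.MatchingOn S) : G.ClusterOn S := by
  intro x hx y hy z hz hxy hyz hxz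
  obtain ⟨w, -, -, hw⟩ := h y hy
  exact absurd ((hw x hx hxy.symm).trans (hw z hz hyz).symm) hxz

theorem matchingOn_image (φ : H ↪g G) : G.MatchingOn (φ '' T) ↔ H.MatchingOn T := by
  simp [MatchingOn]

theorem MatchingOn.exists_isCopiesK2 [Finite V] (h : G.MatchingOn Set.univ) :
    ∃ n, G.IsCopiesK2 n := by
  choose! s _ hs hs' using fun x => h x trivial
  have hss : ∀ x, s (s x) = x := fun x => (hs' (s x) x trivial (hs x).symm).symm
  have hne : ∀ x, s x ≠ x := fun x => (hs x).ne'
  -- The enumeration e orients every edge {x, s x}; the lower ends L index the copies of K₂.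
  let e := Finite.equivFin V
  let L := {x // e x < e (s x)}
  let d : Fin (Nat.card L) ≃ L := (Finite.equivFin L).symm
  have hd : ∀ i, e (d i).1 < e (s (d i).1) := fun i => (d i).2
  have hdd : ∀ i j, (d i).1 ≠ s (d j).1 := by
    intro i j hij
    have h1 := hd i
    rw [hij, hss] at h1
    exact absurd h1 (hd j).asymm
  have hinj : ∀ i j, (d i).1 = (d j).1 ↔ i = j := fun i j => by
    rw [← Subtype.ext_iff, d.injective.eq_iff]
  have hadj : ∀ x y, G.Adj x y ↔ y = s x := fun x y =>
    ⟨fun hxy => hs' x y trivial hxy, fun hxy => hxy ▸ hs x⟩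
  have hsinj : ∀ x y, s x = s y ↔ x = y := fun x y =>
    ⟨fun hxy => by rw [← hss x, hxy, hss], fun hxy => hxy ▸ rfl⟩
  refine ⟨Nat.card L, isIsomorphic_of_bijective
    (f := fun p => if p.2 = 0 then (d p.1).1 else s (d p.1).1) ⟨?_, ?_⟩ ?_⟩
  · rintro ⟨i, a⟩ ⟨j, b⟩ hij
    fin_cases a <;> fin_cases b <;>
      simp_all [(hdd _ _).symm]
  · intro x
    rcases lt_trichotomy (e x) (e (s x)) with hlt | heq | hlt
    · exact ⟨(d.symm ⟨x, hlt⟩, 0), by simp⟩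
    · exact absurd (e.injective heq).symm (hne x)
    · exact ⟨(d.symm ⟨s x, by rwa [hss]⟩, 1), by simp [hss]⟩
  · rintro ⟨i, a⟩ ⟨j, b⟩
    fin_cases a <;> fin_cases b <;>
      simp [copies, hadj, hss, hsinj, hinj, hdd, (hdd _ _).symm, eq_comm]

theorem copies_matchingOn : (copies n (completeGraph (Fin 2))).MatchingOn Set.univ := by
  rintro ⟨i, a⟩ -
  refine ⟨(i, a + 1), trivial, ?_, ?_⟩
  · fin_cases a <;> simp [copies]
  · rintro ⟨j, b⟩ - ⟨h1, h2⟩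
    obtain rfl : i = j := h1
    fin_cases a <;> fin_cases b <;> simp_all

theorem copies_clusterColorable :
    (copies n (completeGraph (Fin 2))).ClusterColorable Set.univ n := by
  refine ⟨fun p => p.1, fun p _ => p.1.2, ?_⟩
  rintro ⟨i, a⟩ - ⟨j, b⟩ - hne
  simp only [copies, completeGraph, top_adj, Fin.val_inj, and_iff_left_iff_imp]
  rintro rfl rfl
  exact hne rfl

theorem copies_monopolar : (copies n (completeGraph (Fin 2))).Monopolar Set.univ :=
  copies_clusterColorable.monopolarOn.monopolar

theorem copies_monoNumber : (copies n (completeGraph (Fin 2))).monoNumber Set.univ = n := by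
  refine le_antisymm copies_clusterColorable.monopolarOn.monoNumber_le ?_
  obtain ⟨c, hc, h⟩ := copies_matchingOn.clusterOn.clusterColorable_of_monopolarOn
    copies_matchingOn.noIsolatedOn (copies_monopolar (n := n)).monopolarOn
  let f : Fin n → Fin ((copies n (completeGraph (Fin 2))).monoNumber Set.univ) :=
    fun i => ⟨c (i, 0), hc _ trivial⟩
  have hf : Function.Injective f := by
    intro i j hij
    by_contra hne
    have := (h (i, 0) trivial (j, 0) trivial (by simp [hne])).2 (congrArg Fin.val hij)
    exact hne this.1
  simpa using Fintype.card_le_of_injective f hf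

theorem IsCopiesK2.matchingOn (h : G.IsCopiesK2 n) : G.MatchingOn Set.univ := by
  obtain ⟨e⟩ := h
  rw [← Set.image_univ_of_surjective e.symm.surjective]
  exact (matchingOn_image e.symm.toEmbedding).2 copies_matchingOn

theorem IsCopiesK2.monoNumber_eq (h : G.IsCopiesK2 n) : G.monoNumber Set.univ = n := by
  obtain ⟨e⟩ := h
  rw [← Set.image_univ_of_surjective e.symm.surjective]
  exact (monoNumber_image e.symm.toEmbedding).trans copies_monoNumber

theorem MatchingOn.isCopiesK2 [Finite V] (h : G.MatchingOn Set.univ) :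
    G.IsCopiesK2 (G.monoNumber Set.univ) := by
  obtain ⟨n, hn⟩ := h.exists_isCopiesK2
  rwa [hn.monoNumber_eq]

end Transfer

/-! ### The dichotomy for disjoint unions, criticality, and the butterfly. -/

section Structure

variable {V W : Type*} {G : SimpleGraph V} {H : SimpleGraph W} {A B C R S T : Set V} {U : Set W}
  {u v : V} {i j k n : ℕ}

theorem anticomplete_supp (c : G.ConnectedComponent) : G.Anticomplete c.supp (S \ c.supp) :=
  fun _ hx _ hy hxy => hy.2 ((ConnectedComponent.sound hxy.symm.reachable).trans hx)

theorem exists_embeddings_of_isIsomorphic_sum {W₁ W₂ : Type*} {H₁ : SimpleGraph W₁}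
    {H₂ : SimpleGraph W₂} (h : G.IsIsomorphic (H₁ ⊕g H₂)) :
    ∃ (φ₁ : H₁ ↪g G) (φ₂ : H₂ ↪g G),
      G.Anticomplete (φ₁ '' Set.univ) (φ₂ '' Set.univ) ∧
      (φ₁ '' Set.univ)ᶜ = φ₂ '' Set.univ := by
  obtain ⟨e⟩ := h
  refine ⟨e.symm.toEmbedding.comp Embedding.sumInl, e.symm.toEmbedding.comp Embedding.sumInr,
    ?_, ?_⟩
  · rintro _ ⟨x, -, rfl⟩ _ ⟨y, -, rfl⟩ h
    have : (H₁ ⊕g H₂).Adj (Sum.inl x) (Sum.inr y) := e.symm.map_adj_iff.1 h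
    simp at this
  · ext x
    obtain ⟨y, rfl⟩ := e.symm.surjective x
    rcases y with y | y <;> simp

/-- If the multipartite side has an edge in S, any vertex of it in T would be nonadjacent to both
ends; hence T lies wholly on the cluster side. If it has no edge in S or in T, it is edgeless. -/
theorem PolarOn.dichotomy [Finite V] (h : G.PolarOn (S ∪ T) k) (hdis : Disjoint S T)
    (hanti : G.Anticomplete S T) : G.MonopolarOn (S ∪ T) k ∨
      (∃ i j, i + j ≤ k ∧ G.PolarOn S i ∧ G.ClusterColorable T j) ∨
      ∃ i j, i + j ≤ k ∧ G.PolarOn T i ∧ G.ClusterColorable S j := by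
  have aux : ∀ {S T A : Set V}, Disjoint S T → G.Anticomplete S T →
      G.MultipartiteOn ((S ∪ T) ∩ A) → G.ClusterColorable ((S ∪ T) \ A) k →
      ¬ G.Edgeless (S ∩ A) → ∃ i j, i + j ≤ k ∧ G.PolarOn S i ∧ G.ClusterColorable T j := by
    intro S T A hdis hanti hA hB hE
    simp only [Edgeless] at hE
    push Not at hE
    obtain ⟨x, hx, y, hy, hxy⟩ := hE
    have hT : T \ A = T := by
      refine Set.Subset.antisymm Set.sdiff_subset fun t ht => ⟨ht, fun htA => ?_⟩
      exact hA x ⟨Or.inl hx.1, hx.2⟩ t ⟨Or.inr ht, htA⟩ y ⟨Or.inl hy.1, hy.2⟩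
        (hanti x hx.1 t ht) (hanti.symm t ht y hy.1) hxy
    rw [Set.union_sdiff_distrib, hT] at hB
    obtain ⟨i, j, hij, hi, hj⟩ := hB.split (hdis.mono_left Set.sdiff_subset)
      (hanti.mono Set.sdiff_subset subset_rfl)
    exact ⟨i, j, hij, ⟨A, hA.mono (Set.inter_subset_inter_left A Set.subset_union_left), hi⟩, hj⟩
  obtain ⟨A, hA, hB⟩ := h
  by_cases hS : G.Edgeless (S ∩ A)
  · by_cases hT : G.Edgeless (T ∩ A)
    · refine Or.inl ⟨A, ?_, hB⟩
      rw [Set.union_inter_distrib_right]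
      exact hS.union hT (hanti.mono Set.inter_subset_left Set.inter_subset_left)
    · rw [Set.union_comm] at hA hB
      exact Or.inr (Or.inr (aux hdis.symm hanti.symm hA hB hT))
  · exact Or.inr (Or.inl (aux hdis hanti hA hB hS))

theorem monoNumber_diff_singleton_add [Finite V] (hT : G.Monopolar T) (hST : S ⊆ T)
    (h : G.Anticomplete S (T \ S)) (hu : u ∈ S) :
    G.monoNumber (T \ {u}) = G.monoNumber (S \ {u}) + G.monoNumber (T \ S) := by
  rw [← (hT.mono (Set.sdiff_subset.trans hST)).monoNumber_union (hT.mono Set.sdiff_subset)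
    (Set.disjoint_sdiff_right.mono_left Set.sdiff_subset) (h.mono Set.sdiff_subset subset_rfl)]
  congr 1
  ext x
  simp only [Set.mem_sdiff, Set.mem_singleton_iff, Set.mem_union]
  have : x ∈ S → x ∈ T := fun h => hST h
  have : x = u → x ∈ S := fun h => h ▸ hu
  tauto

variable (G) in
/-- Deleting any vertex of `S` lowers the monopolar number. -/
def CriticalOn (S : Set V) : Prop := ∀ u ∈ S, G.monoNumber (S \ {u}) < G.monoNumber S

/-- An isolated vertex can be added to the edgeless side at no cost. -/
theorem CriticalOn.noIsolatedOn (h : G.CriticalOn S) (hm : G.Monopolar S) :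
    G.NoIsolatedOn S := by
  intro x hx
  by_contra! hiso
  obtain ⟨A, hA, hB⟩ := (hm.mono (Set.sdiff_subset (t := {x}))).monopolarOn
  have : G.MonopolarOn S (G.monoNumber (S \ {x})) := by
    refine ⟨insert x A, ?_, hB.mono ?_ le_rfl⟩
    · rintro y ⟨hy, hyA⟩ z ⟨hz, hzA⟩ hyz
      by_cases hyx : y = x
      · subst hyx; exact hiso z hz hyz
      · by_cases hzx : z = x
        · subst hzx; exact hiso y hy hyz.symm
        · exact hA y ⟨⟨hy, hyx⟩, hyA.resolve_left hyx⟩ z ⟨⟨hz, hzx⟩, hzA.resolve_left hzx⟩ hyz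
    · rintro y ⟨hy, hyA⟩
      exact ⟨⟨hy, fun h => hyA (Or.inl h)⟩, fun h => hyA (Or.inr h)⟩
  have := this.monoNumber_le
  have := h x hx
  omega

/-- A cluster in which every vertex is critical is a disjoint union of copies of `K₂`. -/
theorem CriticalOn.matchingOn (h : G.CriticalOn S) (hm : G.Monopolar S) (hS : G.ClusterOn S) :
    G.MatchingOn S := by
  have hiso := h.noIsolatedOn hm
  intro x hx
  obtain ⟨y, hy, hxy⟩ := hiso x hx
  refine ⟨y, hy, hxy, fun z hz hxz => ?_⟩
  by_contra hzy
  have hyz : G.Adj y z := hS y hy x hx z hz hxy.symm hxz (Ne.symm hzy)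
  -- If x had two neighbours y and z, deleting z would leave no isolated vertex, so all components
  -- would still count, and z could return as a closed twin of x.
  have hiso' : G.NoIsolatedOn (S \ {z}) := by
    rintro w ⟨hw, hwz⟩
    obtain ⟨t, ht, hwt⟩ := hiso w hw
    by_cases htz : t = z
    · subst htz
      by_cases hwx : w = x
      · exact ⟨y, ⟨hy, Ne.symm hzy⟩, hwx ▸ hxy⟩
      · exact ⟨x, ⟨hx, hxz.ne⟩, hS w hw t hz x hx hwt hxz.symm hwx⟩
    · exact ⟨t, ⟨ht, htz⟩, hwt⟩
  have hc := (hS.mono Set.sdiff_subset).clusterColorable_of_monopolarOn hiso'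
    (hm.mono Set.sdiff_subset).monopolarOn
  have hc' := hc.insert_twin ⟨hx, hxz.ne⟩ hxz.symm
    fun b hb => hS.closed_twin hz x hx hxz.symm b hb.1
  have := (hc'.monopolarOn.mono (S := S) (by simp) le_rfl).monoNumber_le
  have := h z hz
  omega

/-- Once u is deleted, its partner goes to the edgeless side and a whole component disappears. -/
theorem MatchingOn.criticalOn [Finite V] (h : G.MatchingOn S) (hm : G.Monopolar S) :
    G.CriticalOn S := by
  intro u hu
  obtain ⟨w, hw, huw, hw'⟩ := h u hu
  have hc := h.clusterOn.clusterColorable_of_monopolarOn h.noIsolatedOn hm.monopolarOn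
  have : G.MonopolarOn (S \ {u}) (G.monoNumber S - 1) := by
    refine ⟨{w}, ?_, (hc.remove_component hu).mono ?_ le_rfl⟩
    · rintro _ ⟨_, rfl⟩ _ ⟨_, rfl⟩ h; exact h.ne rfl
    · rintro x ⟨⟨hx, hxu⟩, hxw⟩
      exact ⟨hx, hxu, fun h => hxw (hw' x hx h)⟩
  have := this.monoNumber_le
  have := hm.monoNumber_pos hu hw huw
  omega

theorem P4Free.polarOn_pred_of_component [Finite V] (hG : G.P4Free) (hCS : C ⊆ S)
    (hanti : G.Anticomplete C (S \ C)) (hC : G.DiamTwo C) (h2 : 2 ≤ G.monoNumber C)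
    (hR : G.ClusterOn (S \ C)) (hR' : G.NoIsolatedOn (S \ C)) (hm : G.Monopolar S) :
    G.PolarOn S (G.monoNumber S - 1) := by
  have h1 := hG.polarOn_pred hC (hm.mono hCS) h2
  have h3 := hR.clusterColorable_of_monopolarOn hR' (hm.mono Set.sdiff_subset).monopolarOn
  have h4 := h1.union_clusterColorable h3 Set.disjoint_sdiff_right hanti
  rw [Set.union_sdiff_cancel hCS] at h4
  refine h4.mono subset_rfl ?_
  rw [hm.monoNumber_add_diff hCS hanti]
  omega

/-- Used to see that a monopolar minimal (1,k-1)-polar obstruction has m exactly k. The vertex is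
taken in a component with an edge; if that component has m ≤ 1, any of its vertices will do. -/
theorem P4Free.exists_monoNumber_univ_le [Finite V] (hG : G.P4Free)
    (hm : G.Monopolar Set.univ) (hpos : 0 < G.monoNumber Set.univ) :
    ∃ u, G.monoNumber Set.univ ≤ G.monoNumber (Set.univ \ {u}) + 1 := by
  have : ¬ G.Edgeless Set.univ := by
    intro h
    have : G.MonopolarOn Set.univ 0 := ⟨Set.univ, by simpa, by simpa using clusterColorable_empty⟩
    have := this.monoNumber_le
    omega
  simp only [Edgeless] at this
  push Not at this
  obtain ⟨x, -, y, -, hxy⟩ := this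
  let c := G.connectedComponentMk x
  have hanti := anticomplete_supp (S := Set.univ) c
  have hadd := hm.monoNumber_add_diff (Set.subset_univ c.supp) hanti
  by_cases h2 : 2 ≤ G.monoNumber c.supp
  · obtain ⟨u, hu, hu', -⟩ := hG.exists_monoNumber_le_succ (hG.diamTwo_supp c)
      (hm.mono (Set.subset_univ _)) h2
    have := monoNumber_diff_singleton_add hm (Set.subset_univ _) hanti hu
    exact ⟨u, by omega⟩
  · have := monoNumber_diff_singleton_add hm (Set.subset_univ _) hanti (u := x) rfl
    exact ⟨x, by omega⟩

theorem ButterflyOn.image (φ : H ↪g G) (h : H.ButterflyOn U) : G.ButterflyOn (φ '' U) := by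
  obtain ⟨z, a₁, a₂, b₁, b₂, rfl, h⟩ := h
  refine ⟨φ z, φ a₁, φ a₂, φ b₁, φ b₂, by simp [Set.image_insert_eq], ?_⟩
  simpa using h

theorem ButterflyOn.of_image (φ : H ↪g G) (h : G.ButterflyOn (φ '' U)) : H.ButterflyOn U := by
  obtain ⟨z, a₁, a₂, b₁, b₂, hU, h⟩ := h
  obtain ⟨z, -, rfl⟩ : z ∈ φ '' U := by rw [hU]; simp
  obtain ⟨a₁, -, rfl⟩ : a₁ ∈ φ '' U := by rw [hU]; simp
  obtain ⟨a₂, -, rfl⟩ : a₂ ∈ φ '' U := by rw [hU]; simp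
  obtain ⟨b₁, -, rfl⟩ : b₁ ∈ φ '' U := by rw [hU]; simp
  obtain ⟨b₂, -, rfl⟩ : b₂ ∈ φ '' U := by rw [hU]; simp
  refine ⟨z, a₁, a₂, b₁, b₂, Set.image_injective.2 φ.injective ?_, by simpa using h⟩
  rw [hU]; simp [Set.image_insert_eq]

theorem join_butterflyOn :
    (join (completeGraph (Fin 1)) (copies 2 (completeGraph (Fin 2)))).ButterflyOn Set.univ := by
  refine ⟨Sum.inl 0, Sum.inr (0, 0), Sum.inr (0, 1), Sum.inr (1, 0), Sum.inr (1, 1), ?_, ?_⟩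
  · symm
    rw [Set.eq_univ_iff_forall]
    rintro (i | ⟨i, j⟩)
    · fin_cases i; simp
    · fin_cases i <;> fin_cases j <;> simp
  · simp [join, copies]

theorem ButterflyOn.isIsomorphic (h : G.ButterflyOn S) : (G.induce S).IsIsomorphic
    (join (completeGraph (Fin 1)) (copies 2 (completeGraph (Fin 2)))) := by
  obtain ⟨z, a₁, a₂, b₁, b₂, rfl, hza₁, hza₂, hzb₁, hzb₂, ha, hb, h11, h12, h21, h22,
    n11, n12, n21, n22⟩ := h
  refine isIsomorphic_induce
    (f := Sum.elim (fun _ => z) (fun p => ![![a₁, a₂], ![b₁, b₂]] p.1 p.2)) ?_ ?_ ?_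
  · rintro (i | ⟨i, j⟩) (i' | ⟨i', j'⟩) h
    · exact congrArg Sum.inl (Subsingleton.elim _ _)
    · fin_cases i' <;> fin_cases j' <;> simp_all
    · fin_cases i <;> fin_cases j <;> simp_all
    · fin_cases i <;> fin_cases j <;> fin_cases i' <;> fin_cases j' <;> simp_all
  · rintro (i | ⟨i, j⟩) (i' | ⟨i', j'⟩)
    · simp [join, Subsingleton.elim i i']
    · fin_cases i' <;> fin_cases j' <;> simp [join, *]
    · fin_cases i <;> fin_cases j <;> simp [join, G.adj_comm _ z, *]
    · fin_cases i <;> fin_cases j <;> fin_cases i' <;> fin_cases j' <;>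
        simp [join, copies, *, ha.symm, hb.symm, G.adj_comm b₁ a₁, G.adj_comm b₂ a₁,
          G.adj_comm b₁ a₂, G.adj_comm b₂ a₂]
  · ext x
    simp only [Set.mem_insert_iff, Set.mem_singleton_iff, Set.mem_range, Sum.exists, Prod.exists,
      Fin.exists_fin_two]
    simp [eq_comm, or_assoc]

/-- Here z is the centre. Without it 2K₂ remains; without another vertex a triangle remains, plus
one vertex for the edgeless side. -/
theorem ButterflyOn.monopolarOn (h : G.ButterflyOn S) : ∃ z ∈ S,
    G.ClusterColorable (S \ {z}) 2 ∧ (∀ v ∈ S, v ≠ z → G.Adj z v) ∧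
    ∀ v ∈ S, v ≠ z → G.MonopolarOn (S \ {v}) 1 := by
  classical
  obtain ⟨z, a₁, a₂, b₁, b₂, rfl, hza₁, hza₂, hzb₁, hzb₂, ha, hb, h11, h12, h21, h22,
    n11, n12, n21, n22⟩ := h
  refine ⟨z, by simp, ?_, ?_, ?_⟩
  · refine ⟨fun x => if x = a₁ ∨ x = a₂ then 0 else 1,
      fun x _ => by dsimp only; split <;> omega, ?_⟩
    have := n11.symm
    have := n12.symm
    have := n21.symm
    have := n22.symm
    rintro x ⟨rfl | rfl | rfl | rfl | rfl, hx⟩ y ⟨rfl | rfl | rfl | rfl | rfl, hy⟩ hxy <;>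
      simp_all [G.adj_comm]
  · rintro v (rfl | rfl | rfl | rfl | rfl) hv <;> simp_all
  · have key : ∀ v p q r, ({z, a₁, a₂, b₁, b₂} : Set V) ⊆ {v, z, p, q, r} → G.Adj z p →
        G.Adj z q → G.Adj p q → ¬ G.Adj r p → r ≠ p → r ≠ z → r ≠ q →
        G.MonopolarOn ({z, a₁, a₂, b₁, b₂} \ {v}) 1 := by
      intro v p q r hsub hzp hzq hpq hrp nrp nrz nrq
      refine ⟨{r}, ?_, clusterColorable_of_clique ?_⟩
      · rintro _ ⟨_, rfl⟩ _ ⟨_, rfl⟩ h; exact h.ne rfl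
      · have hx' : ∀ x ∈ (({z, a₁, a₂, b₁, b₂} : Set V) \ {v}) \ {r}, x = z ∨ x = p ∨ x = q := by
          rintro x ⟨⟨hx, hxv⟩, hxr⟩
          have := hsub hx
          simp only [Set.mem_insert_iff, Set.mem_singleton_iff] at this hxv hxr
          tauto
        intro x hx y hy hxy
        rcases hx' x hx with rfl | rfl | rfl <;> rcases hx' y hy with rfl | rfl | rfl <;>
          first
          | exact absurd rfl hxy
          | assumption
          | (apply Adj.symm; assumption)
    rintro v (rfl | rfl | rfl | rfl | rfl) hv
    · exact absurd rfl hv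
    · exact key _ b₁ b₂ a₂ (by intro x; simp; tauto) hzb₁ hzb₂ hb h21 n21 hza₂.ne' n22
    · exact key _ b₁ b₂ a₁ (by intro x; simp; tauto) hzb₁ hzb₂ hb h11 n11 hza₁.ne' n12
    · exact key _ a₁ a₂ b₂ (by intro x; simp; tauto) hza₁ hza₂ ha (fun h => h12 h.symm) n12.symm
        hzb₂.ne' n22.symm
    · exact key _ a₁ a₂ b₁ (by intro x; simp; tauto) hza₁ hza₂ ha (fun h => h11 h.symm) n11.symm
        hzb₁.ne' n21.symm

theorem ButterflyOn.monopolar (h : G.ButterflyOn S) : G.Monopolar S := by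
  obtain ⟨z, hz, hc, -⟩ := h.monopolarOn
  refine ⟨2, {z}, ?_, hc⟩
  rintro _ ⟨_, rfl⟩ _ ⟨_, rfl⟩ h; exact h.ne rfl

/-- The centre is not critical: an edgeless set leaves an end of each edge of 2K₂, and these ends
need two colours. -/
theorem ButterflyOn.exists_two_le (h : G.ButterflyOn S) :
    ∃ z ∈ S, 2 ≤ G.monoNumber (S \ {z}) := by
  have hm := h.monopolar
  obtain ⟨z, a₁, a₂, b₁, b₂, rfl, hza₁, hza₂, hzb₁, hzb₂, ha, hb, h11, h12, h21, h22,
    n11, n12, n21, n22⟩ := h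
  refine ⟨z, by simp, ?_⟩
  by_contra hlt
  obtain ⟨A, hA, c, hc, hB⟩ := (hm.mono (Set.sdiff_subset (t := {z}))).monopolarOn.mono
    subset_rfl (show _ ≤ 1 by omega)
  have m1 : a₁ ∈ ({z, a₁, a₂, b₁, b₂} : Set V) \ {z} := ⟨by simp, hza₁.ne'⟩
  have m2 : a₂ ∈ ({z, a₁, a₂, b₁, b₂} : Set V) \ {z} := ⟨by simp, hza₂.ne'⟩
  have m3 : b₁ ∈ ({z, a₁, a₂, b₁, b₂} : Set V) \ {z} := ⟨by simp, hzb₁.ne'⟩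
  have m4 : b₂ ∈ ({z, a₁, a₂, b₁, b₂} : Set V) \ {z} := ⟨by simp, hzb₂.ne'⟩
  have key : ∀ x ∈ ({z, a₁, a₂, b₁, b₂} : Set V) \ {z}, ∀ y ∈ ({z, a₁, a₂, b₁, b₂} : Set V) \ {z},
      x ≠ y → ¬ G.Adj x y → x ∈ A ∨ y ∈ A := by
    intro x hx y hy hxy hadj
    by_contra! hn
    have h1 := hc x ⟨hx, hn.1⟩
    have h2 := hc y ⟨hy, hn.2⟩
    exact hadj ((hB x ⟨hx, hn.1⟩ y ⟨hy, hn.2⟩ hxy).2 (by omega))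
  have k1 := key a₁ m1 b₁ m3 n11 h11
  have k2 := key a₁ m1 b₂ m4 n12 h12
  have k3 := key a₂ m2 b₁ m3 n21 h21
  have k4 := key a₂ m2 b₂ m4 n22 h22
  have l1 : ¬ (a₁ ∈ A ∧ a₂ ∈ A) := fun h => hA a₁ ⟨m1, h.1⟩ a₂ ⟨m2, h.2⟩ ha
  have l2 : ¬ (b₁ ∈ A ∧ b₂ ∈ A) := fun h => hA b₁ ⟨m3, h.1⟩ b₂ ⟨m4, h.2⟩ hb
  tauto

theorem ButterflyOn.monoNumber (h : G.ButterflyOn S) : G.monoNumber S = 2 := by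
  refine le_antisymm ?_ ?_
  · obtain ⟨z, hz, hc, -⟩ := h.monopolarOn
    refine MonopolarOn.monoNumber_le ⟨{z}, ?_, hc⟩
    rintro _ ⟨_, rfl⟩ _ ⟨_, rfl⟩ h; exact h.ne rfl
  · obtain ⟨z, -, hz⟩ := h.exists_two_le
    exact hz.trans (h.monopolar.monoNumber_mono Set.sdiff_subset)

theorem ButterflyOn.diamTwo (h : G.ButterflyOn S) : G.DiamTwo S := by
  obtain ⟨z, hz, -, hzv, -⟩ := h.monopolarOn
  intro x hx y hy hxy hadj
  have hxz : x ≠ z := by rintro rfl; exact hadj (hzv y hy hxy.symm)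
  have hyz : y ≠ z := by rintro rfl; exact hadj (hzv x hx hxy).symm
  exact ⟨z, hz, (hzv x hx hxz).symm, hzv y hy hyz⟩

theorem ButterflyOn.not_clusterOn (h : G.ButterflyOn S) : ¬ G.ClusterOn S := by
  obtain ⟨z, a₁, a₂, b₁, b₂, rfl, hza₁, hza₂, hzb₁, hzb₂, ha, hb, h11, h12, h21, h22,
    n11, n12, n21, n22⟩ := h
  intro h
  exact h11 (h a₁ (by simp) z (by simp) b₁ (by simp) hza₁.symm hzb₁ n11)

theorem ButterflyOn.noIsolatedOn (h : G.ButterflyOn S) : G.NoIsolatedOn S := by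
  obtain ⟨z, a₁, a₂, b₁, b₂, rfl, hza₁, hza₂, hzb₁, hzb₂, ha, hb, -⟩ := h
  rintro x (rfl | rfl | rfl | rfl | rfl)
  · exact ⟨a₁, by simp, hza₁⟩
  · exact ⟨z, by simp, hza₁.symm⟩
  · exact ⟨z, by simp, hza₂.symm⟩
  · exact ⟨z, by simp, hzb₁.symm⟩
  · exact ⟨z, by simp, hzb₂.symm⟩

theorem induce_monoNumber : (G.induce S).monoNumber Set.univ = G.monoNumber S := by
  rw [← monoNumber_image (Embedding.induce S), image_induce_univ]

theorem induce_matchingOn : (G.induce S).MatchingOn Set.univ ↔ G.MatchingOn S := by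
  rw [← matchingOn_image (Embedding.induce S), image_induce_univ]

theorem isExceptional_iff [Finite V] : G.IsExceptional k ↔
    ∃ C, G.ButterflyOn C ∧ G.Anticomplete C Cᶜ ∧ G.MatchingOn Cᶜ ∧ k = G.monoNumber Cᶜ + 2 := by
  constructor
  · rintro ⟨hk, h⟩
    obtain ⟨φ₁, φ₂, hanti, hcompl⟩ := exists_embeddings_of_isIsomorphic_sum h
    refine ⟨φ₂ '' Set.univ, join_butterflyOn.image φ₂, ?_⟩
    rw [← hcompl, compl_compl]
    refine ⟨hcompl ▸ hanti.symm, (matchingOn_image φ₁).2 copies_matchingOn, ?_⟩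
    rw [monoNumber_image, copies_monoNumber]
    omega
  · rintro ⟨C, hC, hanti, hR, rfl⟩
    refine ⟨by omega, ?_⟩
    obtain ⟨e⟩ := isIsomorphic_sum_induce hanti
    obtain ⟨e₁⟩ := hC.isIsomorphic
    obtain ⟨e₂⟩ := (induce_matchingOn.2 hR).isCopiesK2
    rw [induce_monoNumber] at e₂
    rw [Nat.add_sub_cancel]
    exact ⟨(e.trans Iso.sumComm).trans (e₂.sumCongr e₁)⟩

end Structure

/-! ### Sufficiency: unions of two summands are minimal obstructions. -/

section Sufficiency

variable {V W : Type*} {G : SimpleGraph V} {H : SimpleGraph W} {A B C R S T : Set V} {U : Set W}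
  {u v : V} {i j k n : ℕ}

/-- An obstruction that is not a minimal (1,∞)-polar one is monopolar. Then m ≥ k, every deletion
brings it to at most k - 1, and some deletion costs at most one, so m = k. Among critical graphs the
clusters are the copies of K₂, which explains the exclusion of kK₂. -/
theorem isOrdinary_iff [Finite V] (hG : G.P4Free) (hk : 0 < k) : G.IsOrdinary k ↔
    G.Monopolar Set.univ ∧ ¬ G.ClusterOn Set.univ ∧ G.CriticalOn Set.univ ∧
      G.monoNumber Set.univ = k := by
  constructor
  · rintro ⟨hmin, htop, hcop⟩
    have hm := hmin.not_top_iff.1 htop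
    obtain ⟨-, hnot, hdel⟩ := isCographMinObstruction_one_iff.1 hmin
    rw [hm.monopolarOn_iff] at hnot
    obtain ⟨u, hu⟩ := hG.exists_monoNumber_univ_le hm (by omega)
    have := (hdel u).monoNumber_le
    have hcrit : G.CriticalOn Set.univ := fun v _ => by
      have := (hdel v).monoNumber_le
      omega
    have hk' : G.monoNumber Set.univ = k := by omega
    exact ⟨hm, fun h => hcop (hk' ▸ (hcrit.matchingOn hm h).isCopiesK2), hcrit, hk'⟩
  · rintro ⟨hm, hcl, hcrit, rfl⟩
    have hmin : G.IsCographMinObstruction 1 ((G.monoNumber Set.univ - 1 : ℕ) : ℕ∞) := by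
      refine isCographMinObstruction_one_iff.2 ⟨hG, ?_, fun v => ?_⟩
      · rw [hm.monopolarOn_iff]; omega
      · rw [(hm.mono Set.sdiff_subset).monopolarOn_iff]
        have := hcrit v trivial
        omega
    exact ⟨hmin, hmin.not_top_iff.2 hm, fun h => hcl h.matchingOn.clusterOn⟩

theorem ConnectedComponent.adj_of_isIsomorphic {c : G.ConnectedComponent}
    (h : c.toSimpleGraph.IsIsomorphic (completeGraph (Fin n))) {x y : V} (hx : x ∈ c.supp)
    (hy : y ∈ c.supp) (hxy : x ≠ y) : G.Adj x y := by
  obtain ⟨e⟩ := h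
  have : c.toSimpleGraph.Adj ⟨x, hx⟩ ⟨y, hy⟩ := by
    rw [← e.map_adj_iff]
    exact e.injective.ne fun h => hxy (congrArg Subtype.val h)
  exact this

theorem ConnectedComponent.isIsomorphic_completeGraph_two {c : G.ConnectedComponent} {x y : V}
    (hxy : G.Adj x y) (hc : c.supp = {x, y}) :
    c.toSimpleGraph.IsIsomorphic (completeGraph (Fin 2)) := by
  refine isIsomorphic_induce (f := ![x, y]) ?_ ?_ ?_
  · intro i j h
    fin_cases i <;> fin_cases j <;> simp_all [hxy.ne, hxy.ne']
  · intro i j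
    fin_cases i <;> fin_cases j <;> simp [hxy, hxy.symm]
  · rw [hc]; ext z; simp [eq_comm, or_comm]

theorem ConnectedComponent.isIsomorphic_pathGraph_three {c : G.ConnectedComponent} {x y z : V}
    (hxy : G.Adj x y) (hyz : G.Adj y z) (hxz : ¬ G.Adj x z) (hne : x ≠ z)
    (hc : c.supp = {x, y, z}) : c.toSimpleGraph.IsIsomorphic (pathGraph 3) := by
  refine isIsomorphic_induce (f := ![x, y, z]) ?_ ?_ ?_
  · intro i j h
    fin_cases i <;> fin_cases j <;> simp_all [hxy.ne, hxy.ne', hyz.ne, hyz.ne', hne.symm]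
  · intro i j
    fin_cases i <;> fin_cases j <;>
      simp [hxy, hxy.symm, hyz, hyz.symm, hxz, G.adj_comm z x, pathGraph_adj]
  · rw [hc]; ext w; simp [eq_comm, or_comm, or_left_comm]

/-- The exceptional component c has m(c) ≥ 2: otherwise any vertex of c off a fixed edge would not
be critical, so c would be K₂. One unit is saved inside c, and the remaining copies of K₂ form a
cluster. -/
theorem CriticalOn.polarOn_of_existsUnique [Finite V] (hcrit : G.CriticalOn Set.univ)
    (hG : G.P4Free) (hm : G.Monopolar Set.univ)
    (h : ∃! c : G.ConnectedComponent,
      ¬ c.toSimpleGraph.IsIsomorphic (completeGraph (Fin 2))) :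
    G.PolarOn Set.univ (G.monoNumber Set.univ - 1) := by
  obtain ⟨c, hc, huniq⟩ := h
  have hanti := anticomplete_supp (S := Set.univ) c
  have hiso := hcrit.noIsolatedOn hm
  have hadd := hm.monoNumber_add_diff (Set.subset_univ c.supp) hanti
  have hmc := hm.mono (Set.subset_univ c.supp)
  have hmem : ∀ {x y}, G.Adj x y → (x ∈ c.supp ↔ y ∈ c.supp) := fun hxy =>
    ⟨fun h => (ConnectedComponent.sound hxy.symm.reachable).trans h,
      fun h => (ConnectedComponent.sound hxy.reachable).trans h⟩
  refine hG.polarOn_pred_of_component (Set.subset_univ c.supp) hanti (hG.diamTwo_supp c) ?_ ?_ ?_ hm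
  · by_contra hlt
    obtain ⟨x, hx⟩ := c.nonempty_supp
    obtain ⟨y, -, hxy⟩ := hiso x trivial
    have hy := (hmem hxy).1 hx
    refine hc (ConnectedComponent.isIsomorphic_completeGraph_two hxy ?_)
    refine Set.Subset.antisymm (fun z hz => ?_) ?_
    · by_contra hzne
      simp only [Set.mem_insert_iff, Set.mem_singleton_iff, not_or] at hzne
      have h1 := monoNumber_diff_singleton_add hm (Set.subset_univ c.supp) hanti hz
      have h2 := hcrit z trivial
      have h3 := (hmc.mono (Set.sdiff_subset (t := {z}))).monoNumber_pos ⟨hx, Ne.symm hzne.1⟩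
        ⟨hy, Ne.symm hzne.2⟩ hxy
      omega
    · rintro z (rfl | rfl)
      exacts [hx, hy]
  · rintro x ⟨-, hx⟩ y - z - hxy hyz hxz
    have hne : G.connectedComponentMk x ≠ c := hx
    have hK : (G.connectedComponentMk x).toSimpleGraph.IsIsomorphic (completeGraph (Fin 2)) := by
      by_contra h
      exact hne (huniq _ h)
    exact ConnectedComponent.adj_of_isIsomorphic hK rfl
      (ConnectedComponent.sound (hxy.reachable.trans hyz.reachable).symm) hxz
  · rintro x ⟨-, hx⟩
    obtain ⟨y, -, hxy⟩ := hiso x trivial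
    exact ⟨y, ⟨trivial, fun h => hx ((hmem hxy).2 h)⟩, hxy⟩

variable (G) in
/-- The common properties of the two parts into which a disconnected minimal obstruction to
`(∞, k)`-polarity splits. -/
def SummandOn (S : Set V) : Prop :=
  G.Monopolar S ∧ ¬ G.ClusterOn S ∧ G.NoIsolatedOn S ∧
    ∀ v ∈ S, G.monoNumber (S \ {v}) < G.monoNumber S ∨
      G.ClusterColorable (S \ {v}) (G.monoNumber S)

theorem criticalOn_image (φ : H ↪g G) : G.CriticalOn (φ '' U) ↔ H.CriticalOn U := by
  have : ∀ x, φ '' U \ {φ x} = φ '' (U \ {x}) := fun x => by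
    rw [Set.image_sdiff φ.injective, Set.image_singleton]
  simp [CriticalOn, this, monoNumber_image]

theorem SummandOn.image (φ : H ↪g G) (h : H.SummandOn U) : G.SummandOn (φ '' U) := by
  have : ∀ x, φ '' U \ {φ x} = φ '' (U \ {x}) := fun x => by
    rw [Set.image_sdiff φ.injective, Set.image_singleton]
  obtain ⟨h1, h2, h3, h4⟩ := h
  refine ⟨(monopolar_image φ).2 h1, fun h => h2 ((clusterOn_image φ).1 h), ?_, ?_⟩
  · simpa [NoIsolatedOn] using h3
  · rintro _ ⟨x, hx, rfl⟩
    rw [this, monoNumber_image, monoNumber_image, clusterColorable_image]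
    exact h4 x hx

theorem IsOrdinary.summandOn [Finite V] (h : G.IsOrdinary k) (hG : G.P4Free) (hk : 0 < k) :
    G.SummandOn Set.univ := by
  obtain ⟨hm, hcl, hcrit, -⟩ := (isOrdinary_iff hG hk).1 h
  exact ⟨hm, hcl, hcrit.noIsolatedOn hm, fun v hv => Or.inl (hcrit v hv)⟩

theorem IsExceptional.summandOn [Finite V] (h : G.IsExceptional k) (hG : G.P4Free) :
    G.SummandOn Set.univ ∧ G.monoNumber Set.univ = k ∧ G.PolarOn Set.univ (k - 1) := by
  obtain ⟨C, hC, hanti, hR, rfl⟩ := isExceptional_iff.1 h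
  rw [Set.compl_eq_univ_sdiff] at *
  obtain ⟨c, hc⟩ := hR.clusterOn.exists_colorable
  have hmR := hc.monopolarOn.monopolar
  have hm : G.Monopolar Set.univ := by
    have := hC.monopolar.union hmR Set.disjoint_sdiff_right hanti
    rwa [Set.union_sdiff_cancel (Set.subset_univ C)] at this
  have hadd := hm.monoNumber_add_diff (Set.subset_univ C) hanti
  rw [hC.monoNumber] at hadd
  have hmk : G.monoNumber Set.univ = G.monoNumber (Set.univ \ C) + 2 := by omega
  refine ⟨⟨hm, fun h => hC.not_clusterOn (h.mono (Set.subset_univ C)), ?_, ?_⟩, hmk, ?_⟩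
  · intro x _
    by_cases hx : x ∈ C
    · obtain ⟨y, -, hxy⟩ := hC.noIsolatedOn x hx
      exact ⟨y, trivial, hxy⟩
    · obtain ⟨y, -, hxy⟩ := hR.noIsolatedOn x ⟨trivial, hx⟩
      exact ⟨y, trivial, hxy⟩
  · intro v _
    by_cases hv : v ∈ C
    · obtain ⟨z, hz, hz2, -, hz'⟩ := hC.monopolarOn
      -- Only the centre fails to lower m; its deletion leaves 2K₂ and the other copies of K₂, a
      -- cluster with m components.
      by_cases hvz : v = z
      · subst hvz
        right
        have h1 := hR.clusterOn.clusterColorable_of_monopolarOn hR.noIsolatedOn hmR.monopolarOn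
        refine (hz2.union h1 (Set.disjoint_sdiff_right.mono_left Set.sdiff_subset)
          (hanti.mono Set.sdiff_subset subset_rfl)).mono ?_ hadd.ge
        rintro x ⟨-, hx⟩
        by_cases hxC : x ∈ C
        · exact Or.inl ⟨hxC, hx⟩
        · exact Or.inr ⟨trivial, hxC⟩
      · have := monoNumber_diff_singleton_add hm (Set.subset_univ C) hanti hv
        have := (hz' v hv hvz).monoNumber_le
        left; omega
    · have hss : Set.univ \ (Set.univ \ C) = C := by simp
      have h1 := monoNumber_diff_singleton_add hm (Set.subset_univ (Set.univ \ C))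
        (by rw [hss]; exact hanti.symm) (u := v) ⟨trivial, hv⟩
      rw [hss, hC.monoNumber] at h1
      have := hR.criticalOn hmR v ⟨trivial, hv⟩
      left; omega
  · have := hG.polarOn_pred_of_component (Set.subset_univ C) hanti hC.diamTwo hC.monoNumber.ge
      hR.clusterOn hR.noIsolatedOn hm
    rwa [hmk] at this

theorem SummandOn.polarOn [Finite V] (hS : G.SummandOn S) (hT : G.SummandOn T)
    (hdis : Disjoint S T) (hanti : G.Anticomplete S T) (hU : Set.univ = S ∪ T)
    (hST : ¬ G.CriticalOn S → G.PolarOn T (G.monoNumber T - 1))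
    (hk : k + 1 = G.monoNumber S + G.monoNumber T) (hv : v ∈ S) :
    G.PolarOn (Set.univ \ {v}) k := by
  have hvT : v ∉ T := Set.disjoint_left.1 hdis hv
  have hUv : Set.univ \ {v} = (S \ {v}) ∪ T := by
    rw [hU, Set.union_sdiff_distrib, Set.sdiff_singleton_eq_self hvT]
  rw [hUv]
  have hdis' := hdis.mono_left (Set.sdiff_subset (s := S) (t := {v}))
  have hanti' := hanti.mono (Set.sdiff_subset (s := S) (t := {v})) subset_rfl
  obtain ⟨hmS, -, -, hdel⟩ := hS
  by_cases hlt : G.monoNumber (S \ {v}) < G.monoNumber S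
  · have := (hmS.mono (Set.sdiff_subset (t := {v}))).monopolarOn.union hT.1.monopolarOn hdis' hanti'
    exact this.polarOn.mono subset_rfl (by omega)
  -- If S - v only becomes a cluster with m(S) colours, the missing unit is saved in T.
  · have h1 := (hST fun h => hlt (h v hv)).union_clusterColorable ((hdel v hv).resolve_left hlt)
      hdis'.symm hanti'.symm
    rw [Set.union_comm] at h1
    refine h1.mono subset_rfl ?_
    have : 0 < G.monoNumber T := by
      by_contra h0
      refine hT.2.1 fun x hx y hy z hz hxy => ?_
      exact absurd hxy (hT.1.edgeless_of_monoNumber_eq_zero (by omega) x hx y hy)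
    omega

theorem SummandOn.not_polarOn [Finite V] (hS : G.SummandOn S) (hT : G.SummandOn T)
    (hdis : Disjoint S T) (hanti : G.Anticomplete S T)
    (hk : k + 1 = G.monoNumber S + G.monoNumber T) : ¬ G.PolarOn (S ∪ T) k := by
  intro h
  rcases h.dichotomy hdis hanti with h | ⟨i, j, -, -, h⟩ | ⟨i, j, -, -, h⟩
  · have := h.monoNumber_le
    rw [hS.1.monoNumber_union hT.1 hdis hanti] at this
    omega
  · exact hT.2.1 h.clusterOn
  · exact hS.2.1 h.clusterOn

theorem IsOrdinary.polarOn_pred [Finite V] (h : G.IsOrdinary k) (hG : G.P4Free) (hk : 0 < k)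
    (hu : G.IsCographMinObstruction 1 ((k - 1 : ℕ) : ℕ∞) →
      ∃! c : G.ConnectedComponent, ¬ c.toSimpleGraph.IsIsomorphic (completeGraph (Fin 2))) :
    G.PolarOn Set.univ (G.monoNumber Set.univ - 1) := by
  obtain ⟨hm, -, hcrit, -⟩ := (isOrdinary_iff hG hk).1 h
  exact hcrit.polarOn_of_existsUnique hG hm (hu h.1)

theorem summandOn_of_isOrdinary_or_isExceptional [Finite V] (hG : G.P4Free) (hk : 0 < k)
    (h : G.IsOrdinary k ∨ G.IsExceptional k) :
    G.SummandOn Set.univ ∧ G.monoNumber Set.univ = k ∧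
      (¬ G.CriticalOn Set.univ → G.IsExceptional k) := by
  rcases h with h | h
  · exact ⟨h.summandOn hG hk, ((isOrdinary_iff hG hk).1 h).2.2.2,
      fun hn => absurd ((isOrdinary_iff hG hk).1 h).2.2.1 hn⟩
  · exact ⟨(h.summandOn hG).1, (h.summandOn hG).2.1, fun _ => h⟩

theorem polarOn_pred_of_isOrdinary_or_isExceptional [Finite V] (hG : G.P4Free) (hk : 0 < k)
    (h : G.IsOrdinary k ∨ G.IsExceptional k)
    (hu : G.IsCographMinObstruction 1 ((k - 1 : ℕ) : ℕ∞) →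
      ∃! c : G.ConnectedComponent, ¬ c.toSimpleGraph.IsIsomorphic (completeGraph (Fin 2))) :
    G.PolarOn Set.univ (G.monoNumber Set.univ - 1) := by
  rcases h with h | h
  · exact h.polarOn_pred hG hk hu
  · have := h.summandOn hG
    rw [this.2.1]
    exact this.2.2

theorem isCographMinObstruction_of_sum [Finite V] {W₁ W₂ : Type*} {H₁ : SimpleGraph W₁}
    {H₂ : SimpleGraph W₂} {k₁ k₂ : ℕ} (hk₁ : 0 < k₁) (hk₂ : 0 < k₂) (hH₁ : H₁.IsCograph)
    (hH₂ : H₂.IsCograph) (hG : G.IsIsomorphic (H₁ ⊕g H₂))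
    (h₁ : H₁.IsOrdinary k₁ ∨ H₁.IsExceptional k₁) (h₂ : H₂.IsOrdinary k₂ ∨ H₂.IsExceptional k₂)
    (h₁₂ : H₁.IsExceptional k₁ → H₂.IsCographMinObstruction 1 ((k₂ - 1 : ℕ) : ℕ∞) →
      ∃! c : H₂.ConnectedComponent, ¬ c.toSimpleGraph.IsIsomorphic (completeGraph (Fin 2)))
    (h₂₁ : H₂.IsExceptional k₂ → H₁.IsCographMinObstruction 1 ((k₁ - 1 : ℕ) : ℕ∞) →
      ∃! c : H₁.ConnectedComponent, ¬ c.toSimpleGraph.IsIsomorphic (completeGraph (Fin 2))) :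
    ¬ G.Preconnected ∧ G.IsCographMinObstruction ⊤ ((k₁ + k₂ - 1 : ℕ) : ℕ∞) ∧
      ∀ v, ¬ G.IsIsolated v := by
  have hP : G.P4Free := by
    obtain ⟨e⟩ := hG
    exact ((isCograph_iff_p4Free.1 hH₁).sum (isCograph_iff_p4Free.1 hH₂)).comap e.toEmbedding
  obtain ⟨φ₁, φ₂, hanti, hcompl⟩ := exists_embeddings_of_isIsomorphic_sum hG
  have : Finite W₁ := Finite.of_injective φ₁ φ₁.injective
  have : Finite W₂ := Finite.of_injective φ₂ φ₂.injective
  have hP₁ := isCograph_iff_p4Free.1 hH₁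
  have hP₂ := isCograph_iff_p4Free.1 hH₂
  obtain ⟨hs₁, hm₁, hc₁⟩ := summandOn_of_isOrdinary_or_isExceptional hP₁ hk₁ h₁
  obtain ⟨hs₂, hm₂, hc₂⟩ := summandOn_of_isOrdinary_or_isExceptional hP₂ hk₂ h₂
  have hS := hs₁.image φ₁
  have hT := hs₂.image φ₂
  have hS' : ¬ G.CriticalOn (φ₁ '' Set.univ) →
      G.PolarOn (φ₂ '' Set.univ) (G.monoNumber (φ₂ '' Set.univ) - 1) := by
    rw [criticalOn_image, monoNumber_image, polarOn_image]
    exact fun hn => polarOn_pred_of_isOrdinary_or_isExceptional hP₂ hk₂ h₂ (h₁₂ (hc₁ hn))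
  have hT' : ¬ G.CriticalOn (φ₂ '' Set.univ) →
      G.PolarOn (φ₁ '' Set.univ) (G.monoNumber (φ₁ '' Set.univ) - 1) := by
    rw [criticalOn_image, monoNumber_image, polarOn_image]
    exact fun hn => polarOn_pred_of_isOrdinary_or_isExceptional hP₁ hk₁ h₁ (h₂₁ (hc₂ hn))
  rw [← monoNumber_image φ₁] at hm₁
  rw [← monoNumber_image φ₂] at hm₂
  generalize φ₁ '' Set.univ = S at *
  generalize φ₂ '' Set.univ = T at *
  have hdis : Disjoint S T := hcompl ▸ disjoint_compl_right
  have hU : Set.univ = S ∪ T := by rw [← hcompl, Set.union_compl_self]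
  have hk : k₁ + k₂ - 1 + 1 = G.monoNumber S + G.monoNumber T := by omega
  refine ⟨?_, isCographMinObstruction_top_iff.2 ⟨hP, ?_, fun v => ?_⟩, fun v hv => ?_⟩
  · intro hconn
    have hne : ∀ {S}, G.SummandOn S → ∃ x, x ∈ S := by
      intro S hS
      by_contra! hn
      exact hS.2.1 fun x hx => absurd hx (hn x)
    obtain ⟨x, hx⟩ := hne hS
    obtain ⟨y, hy⟩ := hne hT
    obtain ⟨p⟩ := hconn x y
    obtain ⟨d, -, hd, hd'⟩ := p.exists_boundary_dart S hx (Set.disjoint_right.1 hdis hy)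
    refine hanti _ hd _ ?_ d.adj
    rwa [← hcompl]
  · rw [hU]; exact hS.not_polarOn hT hdis hanti hk
  · rcases (hU ▸ Set.mem_univ v : v ∈ S ∪ T) with hv | hv
    · exact hS.polarOn hT hdis hanti hU hS' hk hv
    · exact hT.polarOn hS hdis.symm hanti.symm (by rw [hU, Set.union_comm]) hT' (by omega) hv
  · rcases (hU ▸ Set.mem_univ v : v ∈ S ∪ T) with hvS | hvT
    · obtain ⟨y, -, hy⟩ := hS.2.2.1 v hvS
      exact hv y hy
    · obtain ⟨y, -, hy⟩ := hT.2.2.1 v hvT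
      exact hv y hy

end Sufficiency

/-! ### Necessity: the structure of disconnected minimal obstructions. -/

section Necessity

variable {V : Type*} {G : SimpleGraph V} {A B C R S T : Set V} {u v : V} {i j k n : ℕ}

variable (G) in
/-- `G` is a minimal obstruction to `(∞, k)`-polarity among its induced subgraphs. -/
def MinimalNotPolar (k : ℕ) : Prop :=
  ¬ G.PolarOn Set.univ k ∧ ∀ v, G.PolarOn (Set.univ \ {v}) k

theorem monopolar_of_components [Finite V]
    (h : ∀ c : G.ConnectedComponent, G.Monopolar c.supp) : G.Monopolar Set.univ := by
  choose l A hA hB using h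
  let F : Set V := {x | x ∈ A (G.connectedComponentMk x)}
  have hF : G.Edgeless (Set.univ ∩ F) := by
    rintro x ⟨-, hx⟩ y ⟨-, hy⟩ hxy
    have he : G.connectedComponentMk y = G.connectedComponentMk x :=
      ConnectedComponent.sound hxy.symm.reachable
    have hy' : y ∈ A (G.connectedComponentMk y) := hy
    rw [he] at hy'
    exact hA _ x ⟨rfl, hx⟩ y ⟨he, hy'⟩ hxy
  have hF' : G.ClusterOn (Set.univ \ F) := by
    rintro x ⟨-, hx⟩ y ⟨-, hy⟩ z ⟨-, hz⟩ hxy hyz hxz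
    have he : G.connectedComponentMk y = G.connectedComponentMk x :=
      ConnectedComponent.sound hxy.symm.reachable
    have he' : G.connectedComponentMk z = G.connectedComponentMk x :=
      (ConnectedComponent.sound hyz.symm.reachable).trans he
    have hy' : y ∉ A (G.connectedComponentMk y) := hy
    have hz' : z ∉ A (G.connectedComponentMk z) := hz
    rw [he] at hy'
    rw [he'] at hz'
    exact (hB _).clusterOn x ⟨rfl, hx⟩ y ⟨he, hy'⟩ z ⟨he', hz'⟩ hxy hyz hxz
  obtain ⟨l, hl⟩ := hF'.exists_colorable
  exact ⟨l, F, hF, hl⟩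

/-- A fourth vertex can be deleted while keeping the induced path, so that what remains is not a
cluster. -/
theorem exists_mem_supp_ne
    (hP3 : ∀ c : G.ConnectedComponent, ¬ c.toSimpleGraph.IsIsomorphic (pathGraph 3))
    {c : G.ConnectedComponent} {x y z : V} (hx : x ∈ c.supp) (hxy : G.Adj x y) (hyz : G.Adj y z)
    (hxz : ¬ G.Adj x z) (hne : x ≠ z) : ∃ t ∈ c.supp, t ≠ x ∧ t ≠ y ∧ t ≠ z := by
  by_contra! h
  refine hP3 c (ConnectedComponent.isIsomorphic_pathGraph_three hxy hyz hxz hne ?_)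
  have hy : y ∈ c.supp := (ConnectedComponent.sound hxy.symm.reachable).trans hx
  have hz : z ∈ c.supp := (ConnectedComponent.sound hyz.symm.reachable).trans hy
  refine Set.Subset.antisymm (fun t ht => ?_) ?_
  · have := h t ht
    simp only [Set.mem_insert_iff, Set.mem_singleton_iff]
    tauto
  · rintro t (rfl | rfl | rfl)
    exacts [hx, hy, hz]

theorem exists_of_not_clusterOn (h : ¬ G.ClusterOn S) :
    ∃ x ∈ S, ∃ y ∈ S, ∃ z ∈ S, G.Adj x y ∧ G.Adj y z ∧ x ≠ z ∧ ¬ G.Adj x z := by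
  simp only [ClusterOn] at h
  push Not at h
  exact h

theorem univ_diff_eq_union (hU : Set.univ = S ∪ T) (hdis : Disjoint S T) (hv : v ∈ S) :
    Set.univ \ {v} = (S \ {v}) ∪ T := by
  rw [hU, Set.union_sdiff_distrib, Set.sdiff_singleton_eq_self (Set.disjoint_left.1 hdis hv)]

theorem MinimalNotPolar.deletion [Finite V] (hmin : G.MinimalNotPolar k)
    (hU : Set.univ = S ∪ T) (hdis : Disjoint S T) (hanti : G.Anticomplete S T) (hv : v ∈ S) :
    G.MonopolarOn ((S \ {v}) ∪ T) k ∨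
      (∃ i j, i + j ≤ k ∧ G.PolarOn (S \ {v}) i ∧ G.ClusterColorable T j) ∨
      ∃ i j, i + j ≤ k ∧ G.PolarOn T i ∧ G.ClusterColorable (S \ {v}) j := by
  have := hmin.2 v
  rw [univ_diff_eq_union hU hdis hv] at this
  exact this.dichotomy (hdis.mono_left Set.sdiff_subset) (hanti.mono Set.sdiff_subset subset_rfl)

/-- Not being isolated, v returns as a closed twin of a neighbour. -/
theorem ClusterOn.insert_diff_singleton (h : G.ClusterOn S) (hS : G.NoIsolatedOn S) (hv : v ∈ S)
    (hc : G.ClusterColorable (S \ {v}) k) : G.ClusterColorable S k := by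
  obtain ⟨w, hw, hvw⟩ := hS v hv
  refine (hc.insert_twin ⟨hw, hvw.ne'⟩ hvw fun b hb => h.closed_twin hv w hw hvw b hb.1).mono ?_
    le_rfl
  simp

theorem noIsolatedOn_of_anticomplete (hiso : ∀ x, ∃ y, G.Adj x y)
    (hU : Set.univ = S ∪ T) (hanti : G.Anticomplete S T) : G.NoIsolatedOn S := by
  intro x hx
  obtain ⟨y, hy⟩ := hiso x
  exact ⟨y, (hU ▸ Set.mem_univ y : y ∈ S ∪ T).resolve_right fun h => hanti x hx y h hy, hy⟩

theorem MinimalNotPolar.not_polarOn_union (hmin : G.MinimalNotPolar k)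
    (hU : Set.univ = S ∪ T) (hdis : Disjoint S T) (hanti : G.Anticomplete S T)
    (hij : i + j ≤ k) (hS : G.PolarOn S i) (hT : G.ClusterColorable T j) : False := by
  refine hmin.1 ?_
  rw [hU]
  exact (hS.union_clusterColorable hT hdis hanti).mono subset_rfl hij

/-- With a non-monopolar component c, deleting v outside c must leave the rest D a cluster. If D is
a cluster, v returns for free and G is polar; if not, some deletion spares an induced path on three
vertices in D. -/
theorem MinimalNotPolar.monopolar [Finite V] (hmin : G.MinimalNotPolar k)
    (hiso : ∀ x, ∃ y, G.Adj x y) (hdisc : ¬ G.Preconnected)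
    (hP3 : ∀ c : G.ConnectedComponent, ¬ c.toSimpleGraph.IsIsomorphic (pathGraph 3)) :
    G.Monopolar Set.univ := by
  by_contra hnm
  obtain ⟨c, hc⟩ : ∃ c : G.ConnectedComponent, ¬ G.Monopolar c.supp := by
    by_contra! h
    exact hnm (monopolar_of_components h)
  have hanti := anticomplete_supp (S := Set.univ) c
  have hdis : Disjoint c.supp (Set.univ \ c.supp) := Set.disjoint_sdiff_right
  have hU : Set.univ = c.supp ∪ (Set.univ \ c.supp) := by simp
  have hU' : Set.univ = (Set.univ \ c.supp) ∪ c.supp := by simp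
  have hD := noIsolatedOn_of_anticomplete hiso hU' hanti.symm
  have key : ∀ v ∈ Set.univ \ c.supp, ∃ i j, i + j ≤ k ∧ G.PolarOn c.supp i ∧
      G.ClusterColorable ((Set.univ \ c.supp) \ {v}) j := by
    intro v hv
    rcases hmin.deletion hU' hdis.symm hanti.symm hv with h | ⟨i, j, -, -, h⟩ | h
    · exact absurd (h.mono Set.subset_union_right le_rfl).monopolar hc
    · exact absurd h.monopolarOn.monopolar hc
    · exact h
  by_cases hcl : G.ClusterOn (Set.univ \ c.supp)
  · obtain ⟨v, hv⟩ : ∃ v, v ∈ Set.univ \ c.supp := by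
      by_contra! h
      refine hdisc fun x y => ConnectedComponent.eq.1 ?_
      have hmem : ∀ x, x ∈ c.supp := fun x => by simpa using h x
      exact (hmem x).trans (hmem y).symm
    obtain ⟨i, j, hij, hi, hj⟩ := key v hv
    exact hmin.not_polarOn_union hU hdis hanti hij hi (hcl.insert_diff_singleton hD hv hj)
  · obtain ⟨x, hx, y, hy, z, hz, hxy, hyz, hne, hxz⟩ := exists_of_not_clusterOn hcl
    obtain ⟨t, ht, htx, hty, htz⟩ := exists_mem_supp_ne hP3
      (c := G.connectedComponentMk x) rfl hxy hyz hxz hne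
    have htD : t ∈ Set.univ \ c.supp := by
      refine ⟨trivial, fun htc => hx.2 ?_⟩
      have h1 : G.connectedComponentMk t = c := htc
      have h2 : G.connectedComponentMk t = G.connectedComponentMk x := ht
      exact h2.symm.trans h1
    obtain ⟨i, j, -, -, h⟩ := key t htD
    exact hxz (h.clusterOn x ⟨hx, htx.symm⟩ y ⟨hy, hty.symm⟩ z ⟨hz, htz.symm⟩ hxy hyz hne)

theorem ClusterColorable.polarOn_pred [Finite V] (h : G.ClusterColorable S (k + 1)) :
    G.PolarOn S k := by
  rcases S.eq_empty_or_nonempty with rfl | ⟨x, hx⟩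
  · exact ⟨∅, by simp [MultipartiteOn], by simpa using clusterColorable_empty⟩
  · have hcl := h.clusterOn
    refine ⟨{y | y = x ∨ G.Adj x y}, ?_, (h.remove_component hx).mono ?_ le_rfl⟩
    · have hK : ∀ a ∈ S ∩ {y | y = x ∨ G.Adj x y}, ∀ b ∈ S ∩ {y | y = x ∨ G.Adj x y},
          ¬ G.Adj a b → a = b := by
        rintro a ⟨ha, rfl | hxa⟩ b ⟨hb, rfl | hxb⟩ hab
        · rfl
        · exact absurd hxb hab
        · exact absurd hxa.symm hab
        · by_contra hne
          exact hab (hcl a ha x hx b hb hxa.symm hxb hne)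
      intro a ha b hb c hc hab hbc
      rwa [hK a ha b hb hab]
    · rintro y ⟨hy, hy'⟩
      simp only [Set.mem_ofPred_eq, not_or] at hy'
      exact ⟨hy, hy'⟩

/-- In a cluster, a complete multipartite set with an edge lies in one clique, so it costs one extra
colour. -/
theorem ClusterOn.monopolarOn_or_colorable (h : G.ClusterOn S) (hp : G.PolarOn S k) :
    G.MonopolarOn S k ∨ G.ClusterColorable S (k + 1) := by
  obtain ⟨A, hA, hB⟩ := hp
  by_cases hE : G.Edgeless (S ∩ A)
  · exact Or.inl ⟨A, hE, hB⟩
  right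
  simp only [Edgeless] at hE
  push Not at hE
  obtain ⟨x, hx, y, hy, hxy⟩ := hE
  have hAK : ∀ z ∈ S, z ∈ A → z = x ∨ G.Adj x z := by
    intro z hz hzA
    by_contra! hn
    refine hA x hx z ⟨hz, hzA⟩ y hy hn.2 (fun hzy => hn.2 ?_) hxy
    exact h x hx.1 y hy.1 z hz hxy hzy.symm hn.1.symm
  have h1 : G.ClusterColorable {z ∈ S | z = x ∨ G.Adj x z} 1 := by
    refine clusterColorable_of_clique ?_
    rintro a ⟨ha, rfl | hxa⟩ b ⟨hb, rfl | hxb⟩ hab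
    · exact absurd rfl hab
    · exact hxb
    · exact hxa.symm
    · exact h a ha x hx.1 b hb hxa.symm hxb hab
  have h2 : G.ClusterColorable {z ∈ S | ¬ (z = x ∨ G.Adj x z)} k :=
    hB.mono (fun z hz => ⟨hz.1, fun hzA => hz.2 (hAK z hz.1 hzA)⟩) le_rfl
  refine (h2.union h1 ?_ ?_).mono ?_ le_rfl
  · rw [Set.disjoint_left]; rintro z ⟨-, h1⟩ ⟨-, h2⟩; exact h1 h2
  · rintro a ⟨ha, hxa⟩ b ⟨hb, rfl | hxb⟩ hab
    · exact hxa (Or.inr hab.symm)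
    · rw [not_or] at hxa
      exact hxa.2 (h x hx.1 b hb a ha hxb hab.symm (Ne.symm hxa.1))
  · intro z hz
    by_cases h : z = x ∨ G.Adj x z
    · exact Or.inr ⟨hz, h⟩
    · exact Or.inl ⟨hz, h⟩

theorem MinimalNotPolar.not_clusterOn [Finite V] [Nonempty V] (hmin : G.MinimalNotPolar k)
    (hiso : ∀ x, ∃ y, G.Adj x y) : ¬ G.ClusterOn Set.univ := by
  intro hcl
  have hno : G.NoIsolatedOn Set.univ := fun x _ => (hiso x).imp fun y hy => ⟨trivial, hy⟩
  obtain ⟨v⟩ := ‹Nonempty V›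
  refine hmin.1 (ClusterColorable.polarOn_pred ?_)
  rcases (hcl.mono Set.sdiff_subset).monopolarOn_or_colorable (hmin.2 v) with h | h
  · obtain ⟨l, hl⟩ := hcl.exists_colorable
    have hm := hl.monopolarOn.monopolar
    refine hcl.clusterColorable_of_monopolarOn hno (hm.monopolarOn_iff.2 ?_)
    have h1 := hm.monoNumber_le_diff_singleton (hcl.closed_twin (Set.mem_univ v))
    have h2 := h.monoNumber_le
    omega
  · exact hcl.insert_diff_singleton hno trivial h

theorem clusterOn_univ_of_components
    (h : ∀ c : G.ConnectedComponent, G.ClusterOn c.supp) : G.ClusterOn Set.univ := by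
  intro x _ y _ z _ hxy hyz
  have he : G.connectedComponentMk y = G.connectedComponentMk x :=
    ConnectedComponent.sound hxy.symm.reachable
  exact h (G.connectedComponentMk x) x rfl y he z
    ((ConnectedComponent.sound hyz.symm.reachable).trans he) hxy hyz

theorem MinimalNotPolar.exists_component [Finite V] [Nonempty V] (hmin : G.MinimalNotPolar k)
    (hG : G.P4Free) (hm : G.Monopolar Set.univ) (hiso : ∀ x, ∃ y, G.Adj x y)
    (hdisc : ¬ G.Preconnected) :
    ∃ c : G.ConnectedComponent, ¬ G.ClusterOn c.supp ∧ ¬ G.ClusterOn (Set.univ \ c.supp) := by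
  by_contra! hall
  have hncl := hmin.not_clusterOn hiso
  obtain ⟨c, hc⟩ : ∃ c : G.ConnectedComponent, ¬ G.ClusterOn c.supp := by
    by_contra! h
    exact hncl (clusterOn_univ_of_components h)
  have hcl := hall c hc
  have hanti := anticomplete_supp (S := Set.univ) c
  have hdis : Disjoint c.supp (Set.univ \ c.supp) := Set.disjoint_sdiff_right
  have hU : Set.univ = c.supp ∪ (Set.univ \ c.supp) := by simp
  have hU' : Set.univ = (Set.univ \ c.supp) ∪ c.supp := by simp
  have hD := noIsolatedOn_of_anticomplete hiso hU' hanti.symm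
  obtain ⟨v, hv⟩ : ∃ v, v ∈ Set.univ \ c.supp := by
    by_contra! h
    refine hdisc fun x y => ConnectedComponent.eq.1 ?_
    have hmem : ∀ x, x ∈ c.supp := fun x => by simpa using h x
    exact (hmem x).trans (hmem y).symm
  have hmC := hm.mono (Set.subset_univ c.supp)
  have hmD := hm.mono (Set.sdiff_subset (s := Set.univ) (t := c.supp))
  have hadd := hm.monoNumber_add_diff (Set.subset_univ c.supp) hanti
  -- Delete v from the cluster D outside c: its neighbours are closed twins, so m drops by at most
  -- one, and the cluster alternatives of the dichotomy are excluded.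
  have hle : G.monoNumber Set.univ ≤ k + 1 := by
    have h1 : G.monoNumber (Set.univ \ {v}) ≤ k := by
      rcases hmin.deletion hU' hdis.symm hanti.symm hv with
        h | ⟨i, j, -, -, h⟩ | ⟨i, j, hij, hi, hj⟩
      · rw [← univ_diff_eq_union hU' hdis.symm hv] at h
        exact h.monoNumber_le
      · exact absurd h.clusterOn hc
      · exact (hmin.not_polarOn_union hU hdis hanti hij hi
          (hcl.insert_diff_singleton hD hv hj)).elim
    have h2 := hm.monoNumber_le_diff_singleton (v := v) fun w _ hvw b _ hbw hbv => by
      have hw : w ∈ Set.univ \ c.supp := ⟨trivial, fun h => hanti w h v hv hvw.symm⟩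
      by_cases hb : b ∈ c.supp
      · exact iff_of_false (fun h => hanti b hb v hv h.symm) (fun h => hanti b hb w hw h.symm)
      · exact hcl.closed_twin hv w hw hvw b ⟨trivial, hb⟩ hbw hbv
    omega
  have hge : k + 1 ≤ G.monoNumber Set.univ := by
    by_contra hlt
    exact hmin.1 (hm.monopolarOn.mono subset_rfl (by omega)).polarOn
  have hCol : G.ClusterColorable (Set.univ \ c.supp) (G.monoNumber (Set.univ \ c.supp)) :=
    hcl.clusterColorable_of_monopolarOn hD hmD.monopolarOn
  by_cases h2 : 2 ≤ G.monoNumber c.supp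
  · refine hmin.1 ((hG.polarOn_pred_of_component (Set.subset_univ c.supp) hanti
      (hG.diamTwo_supp c) h2 hcl hD hm).mono subset_rfl ?_)
    omega
  have hpos : 0 < G.monoNumber c.supp := by
    obtain ⟨x, hx, y, hy, z, hz, hxy, -⟩ := exists_of_not_clusterOn hc
    exact hmC.monoNumber_pos hx hy hxy
  have hDk : G.monoNumber (Set.univ \ c.supp) = k := by omega
  by_cases hmult : G.MultipartiteOn c.supp
  · have h0 : G.PolarOn c.supp 0 :=
      ⟨c.supp, by simpa using hmult, by simpa using clusterColorable_empty⟩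
    exact hmin.not_polarOn_union hU hdis hanti (by omega) h0 hCol
  simp only [MultipartiteOn] at hmult
  push Not at hmult
  obtain ⟨x, hx, y, hy, z, hz, hxy, hyz, hxz⟩ := hmult
  have nxy : x ≠ y := by rintro rfl; exact hyz hxz
  have nyz : y ≠ z := by rintro rfl; exact hxy hxz
  -- Now m(c) = 1, m(D) = k, and x, y, z induce K₁ + K₂. As w is none of these, G - w still contains
  -- (K₁ + K₂) + D, and each alternative of the dichotomy fails for it.
  obtain ⟨w, hw, hyw, hwx⟩ := hG.diamTwo_supp c y hy x hx nxy.symm fun h => hxy h.symm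
  have hPC : ({x, y, z} : Set V) ⊆ c.supp := by
    rintro t (rfl | rfl | rfl)
    exacts [hx, hy, hz]
  have hwz : w ≠ z := by rintro rfl; exact hyz hyw
  have hPD := hanti.mono hPC subset_rfl
  have hPdis := hdis.mono_left hPC
  have hpol : G.PolarOn ({x, y, z} ∪ (Set.univ \ c.supp)) k := by
    refine (hmin.2 w).mono ?_ le_rfl
    rintro t ((rfl | rfl | rfl) | ht)
    · exact ⟨trivial, hwx.ne'⟩
    · exact ⟨trivial, hyw.ne⟩
    · exact ⟨trivial, hwz.symm⟩
    · exact ⟨trivial, fun h => ht.2 (by rw [Set.mem_singleton_iff.1 h]; exact hw)⟩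
  rcases hpol.dichotomy hPdis hPD with h | ⟨i, j, hij, ⟨A, hA, hB⟩, hj⟩ | ⟨i, j, hij, hi, hj⟩
  · have h1 := h.monoNumber_le
    rw [(hmC.mono hPC).monoNumber_union hmD hPdis hPD] at h1
    have := (hmC.mono hPC).monoNumber_pos (u := x) (v := z) (by simp) (by simp) hxz
    omega
  · have := hj.monopolarOn.monoNumber_le
    obtain rfl : i = 0 := by omega
    obtain ⟨col, hcol, -⟩ := hB
    have hmem : ∀ t ∈ ({x, y, z} : Set V), t ∈ ({x, y, z} : Set V) ∩ A := fun t ht => ⟨ht, by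
      by_contra htA
      exact absurd (hcol t ⟨ht, htA⟩) (Nat.not_lt_zero _)⟩
    exact hA x (hmem x (by simp)) y (hmem y (by simp)) z (hmem z (by simp)) hxy hyz hxz
  -- Since D has m(D) = k, its polarity saves at most one unit; so at most one colour is left for x,
  -- y, z, which do not form a clique.
  · have hki : k ≤ i + 1 := by
      rcases hcl.monopolarOn_or_colorable hi with h | h
      · have := h.monoNumber_le; omega
      · have := h.monopolarOn.monoNumber_le; omega
    obtain ⟨col, hcol, hadj⟩ := hj
    have h1 := hcol x (by simp)
    have h2 := hcol y (by simp)
    exact hxy ((hadj x (by simp) y (by simp) nxy).2 (by omega))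

theorem MinimalNotPolar.monoNumber_or [Finite V] (hmin : G.MinimalNotPolar k)
    (hm : G.Monopolar Set.univ) (hU : Set.univ = S ∪ T) (hdis : Disjoint S T)
    (hanti : G.Anticomplete S T) (hT : ¬ G.ClusterOn T) (hv : v ∈ S) :
    G.monoNumber (S \ {v}) + G.monoNumber T ≤ k ∨
      ∃ i j, i + j ≤ k ∧ G.PolarOn T i ∧ G.ClusterColorable (S \ {v}) j := by
  rcases hmin.deletion hU hdis hanti hv with h | ⟨i, j, -, -, h⟩ | h
  · left
    have h1 := h.monoNumber_le
    rwa [(hm.mono (Set.subset_univ _)).monoNumber_union (hm.mono (Set.subset_univ _))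
      (hdis.mono_left Set.sdiff_subset) (hanti.mono Set.sdiff_subset subset_rfl)] at h1
  · exact absurd h.clusterOn hT
  · exact Or.inr h

theorem MinimalNotPolar.lt_monoNumber (hmin : G.MinimalNotPolar k) (hm : G.Monopolar Set.univ) :
    k < G.monoNumber Set.univ := by
  by_contra hlt
  exact hmin.1 (hm.monopolarOn.mono subset_rfl (by omega)).polarOn

/-- Each deletion in c lowers m(c) or leaves a cluster. Sparing an induced path gives m(c) ≥ 2,
after which `P4Free.exists_monoNumber_le_succ` and `P4Free.butterflyOn` apply. -/
theorem MinimalNotPolar.component [Finite V] (hmin : G.MinimalNotPolar k)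
    (hG : G.P4Free) (hm : G.Monopolar Set.univ)
    (hP3 : ∀ c : G.ConnectedComponent, ¬ c.toSimpleGraph.IsIsomorphic (pathGraph 3))
    {c : G.ConnectedComponent} (hc : ¬ G.ClusterOn c.supp)
    (hc' : ¬ G.ClusterOn (Set.univ \ c.supp)) :
    G.monoNumber Set.univ = k + 1 ∧ (G.CriticalOn c.supp ∨ G.ButterflyOn c.supp) := by
  have hanti := anticomplete_supp (S := Set.univ) c
  have hdis : Disjoint c.supp (Set.univ \ c.supp) := Set.disjoint_sdiff_right
  have hU : Set.univ = c.supp ∪ (Set.univ \ c.supp) := by simp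
  have hadd := hm.monoNumber_add_diff (Set.subset_univ c.supp) hanti
  have hmC := hm.mono (Set.subset_univ c.supp)
  have hlt := hmin.lt_monoNumber hm
  have hor : ∀ v ∈ c.supp, G.monoNumber (c.supp \ {v}) + G.monoNumber (Set.univ \ c.supp) ≤ k ∨
      G.ClusterOn (c.supp \ {v}) := fun v hv =>
    (hmin.monoNumber_or hm hU hdis hanti hc' hv).imp_right fun ⟨_, _, _, _, h⟩ => h.clusterOn
  have h2 : 2 ≤ G.monoNumber c.supp := by
    obtain ⟨x, hx, y, hy, z, hz, hxy, hyz, hne, hxz⟩ := exists_of_not_clusterOn hc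
    obtain ⟨t, ht, htx, hty, htz⟩ := exists_mem_supp_ne hP3 hx hxy hyz hxz hne
    have h1 := (hor t ht).resolve_right fun h =>
      hxz (h x ⟨hx, htx.symm⟩ y ⟨hy, hty.symm⟩ z ⟨hz, htz.symm⟩ hxy hyz hne)
    have h3 := (hmC.mono (Set.sdiff_subset (t := {t}))).monoNumber_pos ⟨hx, htx.symm⟩
      ⟨hy, hty.symm⟩ hxy
    omega
  refine ⟨?_, ?_⟩
  · obtain ⟨u, hu, hu1, hu2⟩ := hG.exists_monoNumber_le_succ (hG.diamTwo_supp c) hmC h2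
    have := (hor u hu).resolve_right hu2
    omega
  · by_contra! hn
    obtain ⟨hn1, hn2⟩ := hn
    simp only [CriticalOn] at hn1
    push Not at hn1
    obtain ⟨u, hu, hu'⟩ := hn1
    refine hn2 (hG.butterflyOn (hG.diamTwo_supp c) hmC h2 (fun v hv => ?_) hu hu')
    exact (hor v hv).imp_left fun h => by omega

theorem isExceptional_induce [Finite V] (hCS : C ⊆ S) (hC : G.ButterflyOn C)
    (hanti : G.Anticomplete C (S \ C)) (hR : G.MatchingOn (S \ C)) :
    (G.induce S).IsExceptional (G.monoNumber (S \ C) + 2) := by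
  let φ := Embedding.induce (G := G) S
  have h1 : φ '' (Subtype.val ⁻¹' C) = C := by
    change Subtype.val '' _ = C
    rw [Subtype.image_preimage_coe, Set.inter_eq_right.2 hCS]
  have h2 : φ '' (Subtype.val ⁻¹' C)ᶜ = S \ C := by
    rw [Set.compl_eq_univ_sdiff, Set.image_sdiff φ.injective, h1, image_induce_univ]
  refine isExceptional_iff.2 ⟨Subtype.val ⁻¹' C, ?_, ?_, ?_, ?_⟩
  · exact ButterflyOn.of_image φ (by rwa [h1])
  · rw [← anticomplete_image φ, h1, h2]; exact hanti
  · rw [← matchingOn_image φ, h2]; exact hR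
  · rw [← monoNumber_image φ, h2]

theorem induce_monopolar : (G.induce S).Monopolar Set.univ ↔ G.Monopolar S := by
  rw [← monopolar_image (Embedding.induce S), image_induce_univ]

theorem induce_clusterOn : (G.induce S).ClusterOn Set.univ ↔ G.ClusterOn S := by
  rw [← clusterOn_image (Embedding.induce S), image_induce_univ]

theorem induce_criticalOn : (G.induce S).CriticalOn Set.univ ↔ G.CriticalOn S := by
  rw [← criticalOn_image (Embedding.induce S), image_induce_univ]

theorem induce_polarOn : (G.induce S).PolarOn Set.univ k ↔ G.PolarOn S k := by
  rw [← polarOn_image (Embedding.induce S), image_induce_univ]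

theorem P4Free.induce (hG : G.P4Free) (S : Set V) : (G.induce S).P4Free :=
  hG.comap (Embedding.induce S)

theorem Monopolar.monoNumber_pos_of_not_clusterOn (hm : G.Monopolar S) (h : ¬ G.ClusterOn S) :
    0 < G.monoNumber S := by
  obtain ⟨x, hx, y, hy, z, hz, hxy, -⟩ := exists_of_not_clusterOn h
  exact hm.monoNumber_pos hx hy hxy

theorem CriticalOn.isOrdinary_induce [Finite V] (h : G.CriticalOn S) (hG : G.P4Free)
    (hm : G.Monopolar S) (hS : ¬ G.ClusterOn S) :
    (G.induce S).IsOrdinary (G.monoNumber S) := by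
  rw [isOrdinary_iff (hG.induce S) (hm.monoNumber_pos_of_not_clusterOn hS), induce_monopolar,
    induce_clusterOn, induce_criticalOn, induce_monoNumber]
  exact ⟨hm, hS, h, rfl⟩

theorem IsExceptional.not_criticalOn [Finite V] (h : G.IsExceptional k) (hG : G.P4Free) :
    ¬ G.CriticalOn Set.univ := by
  obtain ⟨⟨hm, -⟩, -⟩ := h.summandOn hG
  obtain ⟨C, hC, hanti, -⟩ := isExceptional_iff.1 h
  rw [Set.compl_eq_univ_sdiff] at hanti
  intro hcrit
  obtain ⟨z, hz, hz2⟩ := hC.exists_two_le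
  have h1 := hm.monoNumber_add_diff (Set.subset_univ C) hanti
  have h2 := monoNumber_diff_singleton_add hm (Set.subset_univ C) hanti hz
  have h3 := hcrit z trivial
  rw [hC.monoNumber] at h1
  omega

/-- Converse of `CriticalOn.polarOn_of_existsUnique`. Since (1,m-1)-polarity is impossible, the
dichotomy makes everything outside a non-cluster component a cluster, and a critical cluster
consists of copies of K₂. -/
theorem P4Free.existsUnique_component [Finite V] (hG : G.P4Free) (hm : G.Monopolar Set.univ)
    (hcrit : G.CriticalOn Set.univ) (hcl : ¬ G.ClusterOn Set.univ)
    (hp : G.PolarOn Set.univ (G.monoNumber Set.univ - 1)) :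
    ∃! c : G.ConnectedComponent,
      ¬ c.toSimpleGraph.IsIsomorphic (completeGraph (Fin 2)) := by
  obtain ⟨c, hc⟩ : ∃ c : G.ConnectedComponent, ¬ G.ClusterOn c.supp := by
    by_contra! h
    exact hcl (clusterOn_univ_of_components h)
  have hanti := anticomplete_supp (S := Set.univ) c
  have hdis : Disjoint c.supp (Set.univ \ c.supp) := Set.disjoint_sdiff_right
  have hpos := hm.monoNumber_pos_of_not_clusterOn hcl
  have hss : Set.univ \ (Set.univ \ c.supp) = c.supp := by simp
  have hD : G.ClusterOn (Set.univ \ c.supp) := by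
    rw [show Set.univ = c.supp ∪ (Set.univ \ c.supp) by simp] at hp
    rcases hp.dichotomy hdis hanti with h | ⟨i, j, -, -, h⟩ | ⟨i, j, -, -, h⟩
    · rw [show c.supp ∪ (Set.univ \ c.supp) = Set.univ by simp] at h
      have := h.monoNumber_le
      omega
    · exact h.clusterOn
    · exact absurd h.clusterOn hc
  have hmD := hm.mono (Set.sdiff_subset (s := Set.univ) (t := c.supp))
  have hanti' : G.Anticomplete (Set.univ \ c.supp) (Set.univ \ (Set.univ \ c.supp)) := by
    rw [hss]; exact hanti.symm
  have hDc : G.CriticalOn (Set.univ \ c.supp) := by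
    intro u hu
    have h1 := hm.monoNumber_add_diff (Set.subset_univ _) hanti'
    have h2 := monoNumber_diff_singleton_add hm (Set.subset_univ _) hanti' hu
    have := hcrit u trivial
    omega
  have hM := hDc.matchingOn hmD hD
  refine ⟨c, fun h => hc fun x hx y _ z hz _ _ hxz =>
    ConnectedComponent.adj_of_isIsomorphic h hx hz hxz, ?_⟩
  intro c' hc'
  by_contra hne
  obtain ⟨x, rfl⟩ := c'.exists_rep
  have hx : x ∈ Set.univ \ c.supp := ⟨trivial, hne⟩
  obtain ⟨y, hy, hxy, hxy'⟩ := hM x hx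
  obtain ⟨x', -, -, hyx'⟩ := hM y hy
  have hin : ∀ {s t}, s ∈ Set.univ \ c.supp → G.Adj s t → t ∈ Set.univ \ c.supp :=
    fun hs hst => ⟨trivial, fun ht => hanti _ ht _ hs hst.symm⟩
  refine hc' (ConnectedComponent.isIsomorphic_completeGraph_two hxy ?_)
  refine Set.Subset.antisymm (fun w hw => ?_) ?_
  · have hr : G.Reachable x w := (ConnectedComponent.eq.1 hw).symm
    rcases hG.reachable hr with rfl | h | ⟨t, hxt, htw⟩
    · exact Or.inl rfl
    · exact Or.inr (hxy' w (hin hx h) h)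
    · obtain rfl := hxy' t (hin hx hxt) hxt
      left
      exact (hyx' w (hin hy htw) htw).trans (hyx' x hx hxy.symm).symm
  · rintro w (rfl | rfl)
    · rfl
    · exact ConnectedComponent.sound hxy.symm.reachable

/-- Deleting a non-critical vertex u of S does not lower m, so S - u must be a cluster using at
least m(S) colours, and T is left (∞,m(T)-1)-polar. -/
theorem MinimalNotPolar.existsUnique_component [Finite V] (hmin : G.MinimalNotPolar k)
    (hG : G.P4Free) (hm : G.Monopolar Set.univ) (hU : Set.univ = S ∪ T) (hdis : Disjoint S T)
    (hanti : G.Anticomplete S T) (hT : ¬ G.ClusterOn T)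
    (hk : k + 1 = G.monoNumber S + G.monoNumber T) {l : ℕ} (hS : (G.induce S).IsExceptional l)
    (hTmin : (G.induce T).IsCographMinObstruction 1 ((G.monoNumber T - 1 : ℕ) : ℕ∞)) :
    ∃! c : (G.induce T).ConnectedComponent,
      ¬ c.toSimpleGraph.IsIsomorphic (completeGraph (Fin 2)) := by
  have hmT := hm.mono (Set.subset_univ T)
  have hpos := hmT.monoNumber_pos_of_not_clusterOn hT
  have hnc := hS.not_criticalOn (hG.induce S)
  rw [induce_criticalOn] at hnc
  simp only [CriticalOn] at hnc
  push Not at hnc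
  obtain ⟨u, hu, hu'⟩ := hnc
  obtain ⟨i, j, hij, hi, hj⟩ := (hmin.monoNumber_or hm hU hdis hanti hT hu).resolve_left (by omega)
  have := hj.monopolarOn.monoNumber_le
  refine (hG.induce T).existsUnique_component (induce_monopolar.2 hmT) (fun v _ => ?_)
    (fun h => hT (induce_clusterOn.1 h)) ?_
  · have := ((isCographMinObstruction_one_iff.1 hTmin).2.2 v).monoNumber_le
    rw [induce_monoNumber]
    omega
  · rw [induce_monoNumber, induce_polarOn]
    exact hi.mono subset_rfl (by omega)

theorem MinimalNotPolar.isOrdinary_or_isExceptional [Finite V] (hmin : G.MinimalNotPolar k)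
    (hG : G.P4Free) (hm : G.Monopolar Set.univ)
    (hP3 : ∀ c : G.ConnectedComponent, ¬ c.toSimpleGraph.IsIsomorphic (pathGraph 3))
    {c : G.ConnectedComponent} (hc : ¬ G.ClusterOn c.supp)
    (hc' : ¬ G.ClusterOn (Set.univ \ c.supp)) :
    (G.induce c.supp).IsOrdinary (G.monoNumber c.supp) ∨
      (G.induce c.supp).IsExceptional (G.monoNumber c.supp) := by
  rcases (hmin.component hG hm hP3 hc hc').2 with h | h
  · exact Or.inl (h.isOrdinary_induce hG (hm.mono (Set.subset_univ _)) hc)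
  · right
    -- The butterfly alone is the exceptional graph with zero copies of K₂.
    have h0 : G.monoNumber c.supp = G.monoNumber (c.supp \ c.supp) + 2 := by
      rw [h.monoNumber, Set.sdiff_self]
      have := (clusterColorable_empty (G := G) (k := 0)).monopolarOn.monoNumber_le
      omega
    rw [h0]
    exact isExceptional_induce subset_rfl h (by simp [Anticomplete]) (by simp [MatchingOn])

theorem MinimalNotPolar.isOrdinary_or_isExceptional_diff [Finite V] (hmin : G.MinimalNotPolar k)
    (hG : G.P4Free) (hm : G.Monopolar Set.univ)
    (hP3 : ∀ c : G.ConnectedComponent, ¬ c.toSimpleGraph.IsIsomorphic (pathGraph 3))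
    {c : G.ConnectedComponent} (hc : ¬ G.ClusterOn c.supp)
    (hc' : ¬ G.ClusterOn (Set.univ \ c.supp)) :
    (G.induce (Set.univ \ c.supp)).IsOrdinary (G.monoNumber (Set.univ \ c.supp)) ∨
      (G.induce (Set.univ \ c.supp)).IsExceptional (G.monoNumber (Set.univ \ c.supp)) := by
  have hmT := hm.mono (Set.subset_univ (Set.univ \ c.supp))
  by_cases hcrit : G.CriticalOn (Set.univ \ c.supp)
  · exact Or.inl (hcrit.isOrdinary_induce hG hmT hc')
  right
  have hanti := anticomplete_supp (S := Set.univ) c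
  have hdis : Disjoint c.supp (Set.univ \ c.supp) := Set.disjoint_sdiff_right
  have hU : Set.univ = (Set.univ \ c.supp) ∪ c.supp := by simp
  have hadd := hm.monoNumber_add_diff (Set.subset_univ c.supp) hanti
  have hlt := hmin.lt_monoNumber hm
  have hor : ∀ v ∈ Set.univ \ c.supp,
      G.monoNumber ((Set.univ \ c.supp) \ {v}) < G.monoNumber (Set.univ \ c.supp) ∨
      G.ClusterOn ((Set.univ \ c.supp) \ {v}) := fun v hv =>
    (hmin.monoNumber_or hm hU hdis.symm hanti.symm hc hv).imp (fun _ => by omega)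
      fun ⟨_, _, _, _, h⟩ => h.clusterOn
  simp only [CriticalOn] at hcrit
  push Not at hcrit
  obtain ⟨v, hv, hv'⟩ := hcrit
  have hclv := (hor v hv).resolve_left (by omega)
  set T := Set.univ \ c.supp with hT
  set d := G.connectedComponentMk v with hd
  have hdT : d.supp ⊆ T := by
    rintro x hx
    refine ⟨trivial, fun hxc => hv.2 ?_⟩
    exact (hx : G.connectedComponentMk x = d).symm.trans hxc
  have hantid := anticomplete_supp (S := T) d
  have hR : G.ClusterOn (T \ d.supp) := hclv.mono fun x hx =>
    ⟨hx.1, fun h => hx.2 (by rw [Set.mem_singleton_iff.1 h]; rfl)⟩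
  have hdcl : ¬ G.ClusterOn d.supp := by
    intro h
    have := h.union hR hantid
    rw [Set.union_sdiff_cancel hdT] at this
    exact hc' this
  have hdcl' : ¬ G.ClusterOn (Set.univ \ d.supp) := fun h => hc (h.mono fun x hx =>
    ⟨trivial, fun hxd => (hdT hxd).2 hx⟩)
  have haddT := hmT.monoNumber_add_diff hdT hantid
  -- The component d of the non-critical vertex v is also a non-cluster with a non-cluster
  -- complement, which contains c; it is not critical, so it is a butterfly.
  have hdb : G.ButterflyOn d.supp := by
    refine (hmin.component hG hm hP3 hdcl hdcl').2.resolve_left fun h => ?_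
    have h1 := monoNumber_diff_singleton_add hmT hdT hantid (u := v) rfl
    have h2 := h v rfl
    omega
  have hss : T \ (T \ d.supp) = d.supp := by rw [Set.sdiff_sdiff_cancel_left hdT]
  -- Deleting a vertex outside d keeps d, hence no cluster, so m must drop; the cluster T \ d is
  -- then a union of copies of K₂.
  have hRc : G.CriticalOn (T \ d.supp) := by
    intro u hu
    have h1 := monoNumber_diff_singleton_add hmT (Set.sdiff_subset (t := d.supp))
      (by rw [hss]; exact hantid.symm) hu
    rw [hss] at h1
    have h2 := (hor u hu.1).resolve_right fun h => hdcl (h.mono fun x hx =>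
      ⟨hdT hx, fun hxu => hu.2 (by rw [← Set.mem_singleton_iff.1 hxu]; exact hx)⟩)
    omega
  have hex := isExceptional_induce hdT hdb hantid
    (hRc.matchingOn (hmT.mono Set.sdiff_subset) hR)
  have he : G.monoNumber T = G.monoNumber (T \ d.supp) + 2 := by
    rw [haddT, hdb.monoNumber, add_comm]
  rwa [he]

theorem isIsomorphic_sum_induce_diff (h : G.Anticomplete S (Set.univ \ S)) :
    G.IsIsomorphic (G.induce S ⊕g G.induce (Set.univ \ S)) := by
  rw [← Set.compl_eq_univ_sdiff] at h ⊢
  exact isIsomorphic_sum_induce h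

end Necessity

end SimpleGraph

theorem mainTheorem4 {V : Type u} [Finite V] (G : SimpleGraph V) (k : ℕ) (hk : 0 < k)
    (hP3 : ∀ c : G.ConnectedComponent, ¬ c.toSimpleGraph.IsIsomorphic (SimpleGraph.pathGraph 3)) :
    (¬ G.Preconnected ∧ G.IsCographMinObstruction ⊤ (k : ℕ∞) ∧ ∀ v : V, ¬ G.IsIsolated v) ↔
      ∃ (k₁ k₂ : ℕ) (V₁ V₂ : Type u) (H₁ : SimpleGraph V₁) (H₂ : SimpleGraph V₂),
        0 < k₁ ∧ 0 < k₂ ∧ H₁.IsCograph ∧ H₂.IsCograph ∧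
        G.IsIsomorphic (H₁ ⊕g H₂) ∧
        k = k₁ + k₂ - 1 ∧
        (H₁.IsOrdinary k₁ ∨ H₁.IsExceptional k₁) ∧
        (H₂.IsOrdinary k₂ ∨ H₂.IsExceptional k₂) ∧
        (H₁.IsExceptional k₁ → H₂.IsCographMinObstruction 1 ((k₂ - 1 : ℕ) : ℕ∞) →
          ∃! c : H₂.ConnectedComponent,
            ¬ c.toSimpleGraph.IsIsomorphic (SimpleGraph.completeGraph (Fin 2))) ∧
        (H₂.IsExceptional k₂ → H₁.IsCographMinObstruction 1 ((k₁ - 1 : ℕ) : ℕ∞) →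
          ∃! c : H₁.ConnectedComponent,
            ¬ c.toSimpleGraph.IsIsomorphic (SimpleGraph.completeGraph (Fin 2))) := by
  constructor
  · rintro ⟨hdisc, hobs, hiso⟩
    obtain ⟨hG, hmin⟩ := SimpleGraph.isCographMinObstruction_top_iff.1 hobs
    replace hmin : G.MinimalNotPolar k := hmin
    replace hiso : ∀ x, ∃ y, G.Adj x y := fun x => by
      by_contra! h
      exact hiso x h
    have hne : Nonempty V := by
      by_contra hE
      exact hdisc fun x => (hE ⟨x⟩).elim
    have hm := hmin.monopolar hiso hdisc hP3
    obtain ⟨c, hc, hc'⟩ := hmin.exists_component hG hm hiso hdisc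
    have hanti := SimpleGraph.anticomplete_supp (S := Set.univ) c
    have hdis : Disjoint c.supp (Set.univ \ c.supp) := Set.disjoint_sdiff_right
    have hadd := hm.monoNumber_add_diff (Set.subset_univ c.supp) hanti
    have hk1 := (hmin.component hG hm hP3 hc hc').1
    -- The implicit k₁ and k₂ are the monopolar numbers of c and of the rest, with sum k + 1.
    refine ⟨_, _, _, _, G.induce c.supp, G.induce (Set.univ \ c.supp),
      (hm.mono (Set.subset_univ _)).monoNumber_pos_of_not_clusterOn hc,
      (hm.mono (Set.subset_univ _)).monoNumber_pos_of_not_clusterOn hc',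
      SimpleGraph.isCograph_iff_p4Free.2 (hG.induce _),
      SimpleGraph.isCograph_iff_p4Free.2 (hG.induce _),
      SimpleGraph.isIsomorphic_sum_induce_diff hanti, by omega,
      hmin.isOrdinary_or_isExceptional hG hm hP3 hc hc',
      hmin.isOrdinary_or_isExceptional_diff hG hm hP3 hc hc', fun h h' => ?_, fun h h' => ?_⟩
    · exact hmin.existsUnique_component hG hm (by simp) hdis hanti hc' (by omega) h h'
    · exact hmin.existsUnique_component hG hm (by simp) hdis.symm hanti.symm hc (by omega) h h'
  · rintro ⟨k₁, k₂, V₁, V₂, H₁, H₂, hk₁, hk₂, hH₁, hH₂, hG, rfl, h₁, h₂, h₁₂, h₂₁⟩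
    exact SimpleGraph.isCographMinObstruction_of_sum hk₁ hk₂ hH₁ hH₂ hG h₁ h₂ h₁₂ h₂₁
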